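/- **Setting.** For a metric space $X$ let $\mathrm{Isom}(X)$ be its isometry group with the compact-open topology. An isometric action on a pointed space is a triple $(X,x,G)$ with $X$ a proper metric space, $x\in X$ and $G<\mathrm{Isom}(X)$ a closed subgroup. For $g,h\in G$ and $R>0$ put $$d^\ell_{x,R}(g,h)=\max_{y\in\overline B(x,R)}d(gy,hy),\quad d^{\mathrm r}_{x,R}(g,h)=\max_{y\in\overline B(x,R)}d(g^{-1}y,h^{-1}y),\quad d^{\ast}_x(g,h)=\inf_{R>0}\Big\{\tfrac1R+d^{\ast}_{x,R}(g,h)\Big\}\ \ (\ast\in\{\ell,\mathrm r\});$$ $d^\ell_x$ and $d^{\mathrm r}_x$ are proper metrics on $G$, left and right invariant respectively, which induce its topology. Let $\overline B^{\ast}_x(\mathrm{id},r)$ be the closed balls of $d^{\ast}_x$. *Equivariant convergence.* $(X_j,x_j,G_j)\to(X_\infty,x_\infty,G_\infty)$ in the equivariant pointed Gromov–Hausdorff sense if there are $\varepsilon_j>0$, $\varepsilon_j\to0$, and for each $j$ an equivariant $\varepsilon_j$-approximation in the sense of Fukaya. Writing $G(r)=\{g\in G: d(gx,x)\le r\}$,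 an equivariant $\varepsilon$-approximation from $(X,x,G)$ to $(Y,y,H)$ is a triple of maps $f:\overline B(x,1/\varepsilon)\to Y$, $\varphi:G(1/\varepsilon)\to H(1/\varepsilon)$, $\psi:H(1/\varepsilon)\to G(1/\varepsilon)$ such that $f(x)=y$; $|d(f(a),f(b))-d(a,b)|<\varepsilon$ for all $a,b\in\overline B(x,1/\varepsilon)$; every point of $\overline B(y,1/\varepsilon)$ is at distance $<\varepsilon$ from $f(\overline B(x,1/\varepsilon))$; $d(f(ga),\varphi(g)f(a))<\varepsilon$ whenever $g\in G(1/\varepsilon)$ and $a,ga\in\overline B(x,1/\varepsilon)$; and $d(f(\psi(h)a),hf(a))<\varepsilon$ whenever $h\in H(1/\varepsilon)$ and $a,\psi(h)a\in\overline B(x,1/\varepsilon)$. *Measured convergence.* Let $\mu_j$ be Borel measures on $G_j$ that are finite on compact sets and $\mu_\infty$ a Borel measure (possibly zero) on $G_\infty$. Then $(G_j,\mathrm{id},d^\ell_{x_j},\mu_j)\xrightarrow{\mathrm{pmGH}}(G_\infty,\mathrm{id},d^\ell_{x_\infty},\mu_\infty)$ means that $\mu_\infty$ is finite on compact sets and that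 there are $R_j\to+\infty$, $\varepsilon_j\to0$ and Borel maps $\psi_j:G_j\to G_\infty$ with (a) $\psi_j(\mathrm{id})=\mathrm{id}$; (b) $|d^\ell_{x_j}(g,h)-d^\ell_{x_\infty}(\psi_j(g),\psi_j(h))|<\varepsilon_j$ for all $g,h\in\overline B^\ell_{x_j}(\mathrm{id},R_j)$; (c) for every $k\in\overline B^\ell_{x_\infty}(\mathrm{id},R_j-\varepsilon_j)$ there is $g\in\overline B^\ell_{x_j}(\mathrm{id},R_j)$ with $d^\ell_{x_\infty}(k,\psi_j(g))<\varepsilon_j$; (d) for every continuous compactly supported $f:G_\infty\to\mathbb R$, $$\int_{\overline B^\ell_{x_j}(\mathrm{id},R_j)}f\circ\psi_j\,d\mu_j\longrightarrow\int_{G_\infty}f\,d\mu_\infty .$$ The definition for $d^{\mathrm r}$ is the same with $d^{\mathrm r}$ in place of $d^\ell$. A left (right) invariant Haar measure is a left (right) invariant Borel measure that is finite on compact sets and positive on nonempty open sets. **Proposition.** Suppose that $(X_j,x_j,G_j)\to(X_\infty,x_\infty,G_\infty)$, $j\in\mathbb N$, in the equivariant pointed Gromov–Hausdorff sense, with all $X_j$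 geodesic, and let $\mu_j$ be a left invariant Haar measure on $G_j$ for each $j$. (i) The sequence $(G_j,\mathrm{id},d^\ell_{x_j},\mu_j)$ is precompact for the convergence above (every subsequence has a further subsequence that pmGH-converges to $(G_\infty,\mathrm{id},d^\ell_{x_\infty},\mu_\infty)$ for some measure $\mu_\infty$) if and only if $\sup_j\mu_j(\overline B^\ell_{x_j}(\mathrm{id},R))<+\infty$ for every $R\ge0$. Moreover, whenever a subsequence $(G_{j_k},\mathrm{id},d^\ell_{x_{j_k}},\mu_{j_k})$ pmGH-converges to $(G_\infty,\mathrm{id},d^\ell_{x_\infty},\mu_\infty)$, one has $\sup_k\mu_{j_k}(\overline B^\ell_{x_{j_k}}(\mathrm{id},R))<+\infty$ for every $R\ge 0$, and $\mu_\infty$ is left invariant. (ii) Whenever a subsequence $(G_{j_k},\mathrm{id},d^\ell_{x_{j_k}},\mu_{j_k})$ pmGH-converges to $(G_\infty,\mathrm{id},d^\ell_{x_\infty},\mu_\infty)$, the measure $\mu_\infty$ is a left invariant Haar measure of $G_\infty$ if and only if $\inf_k\mu_{j_k}(\overline B^\ell_{x_{j_k}}(\mathrm{id},r))>0$ for every $r>0$.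 The same statements hold with right invariant Haar measures $\mu_j$, the metrics $d^{\mathrm r}$, their balls $\overline B^{\mathrm r}$, and right invariance in place of left invariance. -/

import Mathlib

open Filter Topology MeasureTheory

universe u v

/-! ### The isometry group of a metric space -/

section IsometryGroup

variable {X : Type u} [MetricSpace X]

/-- The compact-open topology on the isometry group `Isom(X) = X ≃ᵢ X`. -/
instance isomCompactOpen : TopologicalSpace (X ≃ᵢ X) :=
  TopologicalSpace.induced (fun g => (⟨g, g.continuous⟩ : C(X, X))) inferInstance

/-- `Isom(X)` carries its Borel `σ`-algebra. -/
instance isomMeasurableSpace : MeasurableSpace (X ≃ᵢ X) := borel (X ≃ᵢ X)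

instance isomBorelSpace : BorelSpace (X ≃ᵢ X) := ⟨rfl⟩

/-- The left invariant pseudometric at scale `R`:
`d_{x,R}^ℓ(g,h) = max_{y ∈ closedBall x R} d(g y, h y)`. -/
noncomputable def leftDistScale (x : X) (R : ℝ) (g h : X ≃ᵢ X) : ℝ :=
  ⨆ y : Metric.closedBall x R, dist (g y) (h y)

/-- The right invariant pseudometric at scale `R`:
`d_{x,R}^r(g,h) = max_{y ∈ closedBall x R} d(g⁻¹ y, h⁻¹ y)`. -/
noncomputable def rightDistScale (x : X) (R : ℝ) (g h : X ≃ᵢ X) : ℝ :=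
  ⨆ y : Metric.closedBall x R, dist (g⁻¹ (y : X)) (h⁻¹ (y : X))

/-- The left invariant metric `d_x^ℓ(g,h) = inf_{R > 0} (1/R + d_{x,R}^ℓ(g,h))` on `Isom(X)`. -/
noncomputable def leftDist (x : X) (g h : X ≃ᵢ X) : ℝ :=
  ⨅ R : Set.Ioi (0 : ℝ), (1 / (R : ℝ) + leftDistScale x R g h)

/-- The right invariant metric `d_x^r(g,h) = inf_{R > 0} (1/R + d_{x,R}^r(g,h))` on `Isom(X)`. -/
noncomputable def rightDist (x : X) (g h : X ≃ᵢ X) : ℝ :=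
  ⨅ R : Set.Ioi (0 : ℝ), (1 / (R : ℝ) + rightDistScale x R g h)

end IsometryGroup

/-- A metric space is geodesic if any two points are joined by an isometrically embedded
segment. -/
def IsGeodesicSpace (X : Type u) [MetricSpace X] : Prop :=
  ∀ a b : X, ∃ γ : ℝ → X, γ 0 = a ∧ γ (dist a b) = b ∧
    ∀ s ∈ Set.Icc 0 (dist a b), ∀ t ∈ Set.Icc 0 (dist a b), dist (γ s) (γ t) = |s - t|

/-! ### Isometric actions and equivariant pointed Gromov-Hausdorff convergence -/

/-- An isometric action on a pointed space: a triple `(X, x, G)` with `X` a proper metric space,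
`x ∈ X` and `G` a closed subgroup of `Isom(X)`. -/
structure IsometricAction where
  X : Type u
  [metricSpace : MetricSpace X]
  [properSpace : ProperSpace X]
  base : X
  G : Subgroup (X ≃ᵢ X)
  isClosed_G : IsClosed (G : Set (X ≃ᵢ X))

attribute [instance] IsometricAction.metricSpace IsometricAction.properSpace

namespace IsometricAction

/-- The action of an element of the group on the space. -/
def act (A : IsometricAction.{u}) (g : A.G) (a : A.X) : A.X := (g : A.X ≃ᵢ A.X) a

/-- The metric `d_x^ℓ` on the group `G` of the isometric action `(X, x, G)`. -/
noncomputable def dl (A : IsometricAction.{u}) (g h : A.G) : ℝ :=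
  leftDist A.base (g : A.X ≃ᵢ A.X) (h : A.X ≃ᵢ A.X)

/-- The metric `d_x^r` on the group `G` of the isometric action `(X, x, G)`. -/
noncomputable def dr (A : IsometricAction.{u}) (g h : A.G) : ℝ :=
  rightDist A.base (g : A.X ≃ᵢ A.X) (h : A.X ≃ᵢ A.X)

/-- The elements of `G` moving the base point by at most `R`. -/
def displ (A : IsometricAction.{u}) (R : ℝ) : Set A.G := {g | dist (A.act g A.base) A.base ≤ R}

/-- The triple `(f, φ, ψ)` is an equivariant pointed `ε`-approximation from `A` to `B`, in the
sense of Fukaya. The maps are total; their values are only constrained on the balls of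
radius `1/ε`. -/
structure IsEquivariantApprox (A : IsometricAction.{u}) (B : IsometricAction.{v}) (ε : ℝ)
    (f : A.X → B.X) (φ : A.G → B.G) (ψ : B.G → A.G) : Prop where
  map_base : f A.base = B.base
  almost_isometry : ∀ a ∈ Metric.closedBall A.base (1 / ε), ∀ b ∈ Metric.closedBall A.base (1 / ε),
    |dist (f a) (f b) - dist a b| < ε
  almost_surjective : ∀ b ∈ Metric.closedBall B.base (1 / ε),
    ∃ a ∈ Metric.closedBall A.base (1 / ε), dist (f a) b < ε
  map_displ : Set.MapsTo φ (A.displ (1 / ε)) (B.displ (1 / ε))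
  map_displ' : Set.MapsTo ψ (B.displ (1 / ε)) (A.displ (1 / ε))
  almost_equivariant : ∀ g ∈ A.displ (1 / ε), ∀ a ∈ Metric.closedBall A.base (1 / ε),
    A.act g a ∈ Metric.closedBall A.base (1 / ε) →
      dist (f (A.act g a)) (B.act (φ g) (f a)) < ε
  almost_equivariant' : ∀ h ∈ B.displ (1 / ε), ∀ a ∈ Metric.closedBall A.base (1 / ε),
    A.act (ψ h) a ∈ Metric.closedBall A.base (1 / ε) →
      dist (f (A.act (ψ h) a)) (B.act h (f a)) < ε

/-- Equivariant pointed Gromov-Hausdorff convergence of isometric actions. -/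
def EqPGHConverges (A : ℕ → IsometricAction.{u}) (B : IsometricAction.{v}) : Prop :=
  ∃ ε : ℕ → ℝ, (∀ j, 0 < ε j) ∧ Tendsto ε atTop (𝓝 0) ∧
    ∀ j, ∃ (f : (A j).X → B.X) (φ : (A j).G → B.G) (ψ : B.G → (A j).G),
      IsEquivariantApprox (A j) B (ε j) f φ ψ

end IsometricAction

/-! ### Pointed measured Gromov-Hausdorff convergence -/

/-- Pointed measured Gromov-Hausdorff convergence `(H j, 1, d j, μ j) ⟶ (K, 1, dK, μK)` of groups
with distances and measures, pointed at the identity. The limit measure is finite on compact sets,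
the approximations `ψ j` are Borel, and the measure `μ j` is tested on the ball of radius `R j`,
on which `ψ j` is an approximation. -/
def PMGHConverges {H : ℕ → Type u} [∀ j, Group (H j)] [∀ j, MeasurableSpace (H j)]
    {K : Type v} [Group K] [TopologicalSpace K] [MeasurableSpace K]
    (d : ∀ j, H j → H j → ℝ) (μ : ∀ j, Measure (H j))
    (dK : K → K → ℝ) (μK : Measure K) : Prop :=
  IsFiniteMeasureOnCompacts μK ∧
  ∃ (R ε : ℕ → ℝ) (ψ : ∀ j, H j → K),
    Tendsto R atTop atTop ∧ Tendsto ε atTop (𝓝 0) ∧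
    (∀ j, Measurable (ψ j)) ∧
    (∀ j, ψ j 1 = 1) ∧
    (∀ j, ∀ g h : H j, d j 1 g ≤ R j → d j 1 h ≤ R j →
      |d j g h - dK (ψ j g) (ψ j h)| < ε j) ∧
    (∀ j, ∀ k : K, dK 1 k ≤ R j - ε j → ∃ g : H j, d j 1 g ≤ R j ∧ dK k (ψ j g) < ε j) ∧
    (∀ f : K → ℝ, Continuous f → HasCompactSupport f →
      Tendsto (fun j => ∫ g in {g : H j | d j 1 g ≤ R j}, f (ψ j g) ∂(μ j)) atTop
        (𝓝 (∫ k, f k ∂μK)))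

/-- A right invariant Haar measure: right invariant, finite on compact sets and positive on
nonempty open sets. The left invariant notion is `MeasureTheory.Measure.IsHaarMeasure`. -/
structure IsRightHaarMeasure {H : Type u} [Group H] [TopologicalSpace H] [MeasurableSpace H]
    (μ : Measure H) : Prop where
  finite_on_compacts : IsFiniteMeasureOnCompacts μ
  right_invariant : μ.IsMulRightInvariant
  open_pos : μ.IsOpenPosMeasure

namespace IsometricAction

/-- `(G_j, id, d_{x_j}^ℓ, μ_j) ⟶ (G, id, d_x^ℓ, μ)` in the pointed measured Gromov-Hausdorff
sense. -/
def LeftPMGHConverges (A : ℕ → IsometricAction.{u}) (μ : ∀ j, Measure (A j).G)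
    (B : IsometricAction.{v}) (μB : Measure B.G) : Prop :=
  PMGHConverges (fun j => (A j).dl) μ B.dl μB

/-- `(G_j, id, d_{x_j}^r, μ_j) ⟶ (G, id, d_x^r, μ)` in the pointed measured Gromov-Hausdorff
sense. -/
def RightPMGHConverges (A : ℕ → IsometricAction.{u}) (μ : ∀ j, Measure (A j).G)
    (B : IsometricAction.{v}) (μB : Measure B.G) : Prop :=
  PMGHConverges (fun j => (A j).dr) μ B.dr μB

/-- The closed ball of radius `r` about the identity of `G` for the metric `d_x^ℓ`. -/
def leftBall (A : IsometricAction.{u}) (r : ℝ) : Set A.G := {g | A.dl 1 g ≤ r}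

/-- The closed ball of radius `r` about the identity of `G` for the metric `d_x^r`. -/
def rightBall (A : IsometricAction.{u}) (r : ℝ) : Set A.G := {g | A.dr 1 g ≤ r}

end IsometricAction

/-! Each group `G` with `d^ℓ` is a proper metric group with left invariant metric (properness is
Arzelà–Ascoli, `isCompact_setOf_dist_apply_le`), so almost everything happens on abstract proper
metric groups.

Precompactness: `d^ℓ` only compares displacements of two elements at the same point. Hence the group
component of an equivariant approximation almost preserves `d^ℓ` on balls
(`IsEquivariantApprox.isBallApprox`). After discretization it is Borel, the measures can be pushed
to the limit group, and mass bounds on balls give vague compactness (`exists_subseq_pmghConverges`).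
Conversely, testing a convergent sequence against a cutoff bounds the masses.

Invariance of the limit: the maps in a pmGH convergence need not respect multiplication, so
invariance must be read off the metric. Invariance of the measures and metrics makes radial
integrals independent of their centre. Passing to the limit
(`PMGHConverges.tendsto_integral_comp_dist`), balls of equal radius have equal measure. Comparing
with Haar measure by Fubini, as in the uniqueness theorem for uniformly distributed measures, yields
left invariance (`isMulLeftInvariant_of_measure_ball_eq`). The same radial limits decide whether the
limit measure charges small balls, which is (ii).

Right case: inversion is an isometry from `d^r` to `d^ℓ` exchanging the two kinds of invariance. -/

/-! ### Vague compactness -/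

section Vague

open scoped CompactlySupported

/-- Two continuous functions supported in a closed ball and `δ`-close on it have close
integrals. -/
theorem abs_integral_sub_integral_le {K : Type v} [MetricSpace K] [ProperSpace K]
    [MeasurableSpace K] [BorelSpace K] (o : K) (N : ℝ) (ν : Measure K)
    [IsFiniteMeasureOnCompacts ν]
    {f g : K → ℝ} (hf : Continuous f) (hg : Continuous g)
    (hfs : Function.support f ⊆ Metric.closedBall o N)
    (hgs : Function.support g ⊆ Metric.closedBall o N) {δ : ℝ}
    (h : ∀ x ∈ Metric.closedBall o N, |f x - g x| ≤ δ) :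
    |∫ x, f x ∂ν - ∫ x, g x ∂ν| ≤ δ * ν.real (Metric.closedBall o N) := by
  have hcomp : ∀ f : K → ℝ, Function.support f ⊆ Metric.closedBall o N → HasCompactSupport f :=
    fun f hf => HasCompactSupport.of_support_subset_isCompact (isCompact_closedBall o N) hf
  rw [← integral_sub (hf.integrable_of_hasCompactSupport (hcomp f hfs))
    (hg.integrable_of_hasCompactSupport (hcomp g hgs))]
  have hs : ∀ x, x ∉ Metric.closedBall o N → f x - g x = 0 := by
    intro x hx
    have h1 : f x = 0 := by
      by_contra h1
      exact hx (hfs h1)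
    have h2 : g x = 0 := by
      by_contra h2
      exact hx (hgs h2)
    rw [h1, h2, sub_zero]
  rw [← setIntegral_eq_integral_of_forall_compl_eq_zero hs, ← Real.norm_eq_abs]
  exact norm_setIntegral_le_of_norm_le_const (isCompact_closedBall o N).measure_lt_top h

/-- For each `N`, the functions supported in the ball of radius `N` form a separable space.
Convergence on countably many of them suffices, because approximating inside the same class costs at
most the uniform error times the bounded mass of that one ball. -/
theorem exists_subseq_cauchySeq_integral {K : Type v} [MetricSpace K] [ProperSpace K]
    [MeasurableSpace K] [BorelSpace K] (o : K) (ν : ℕ → Measure K)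
    [∀ n, IsFiniteMeasureOnCompacts (ν n)]
    (hb : ∀ R : ℝ, ∃ C : ℝ, ∀ n, (ν n).real (Metric.closedBall o R) ≤ C) :
    ∃ t : ℕ → ℕ, StrictMono t ∧ ∀ f : K → ℝ, Continuous f → HasCompactSupport f →
      CauchySeq (fun n => ∫ x, f x ∂(ν (t n))) := by
  choose C hC using hb
  have hC0 : ∀ R, 0 ≤ C R := fun R => measureReal_nonneg.trans (hC R 0)
  let E : ℕ → Set C(K, ℝ) := fun N => {f | Function.support f ⊆ Metric.closedBall o N}
  have hE0 : ∀ N, (0 : C(K, ℝ)) ∈ E N := fun N => by simp [E]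
  have : ∀ N, Nonempty (E N) := fun N => ⟨⟨0, hE0 N⟩⟩
  let d : ℕ → ℕ → C(K, ℝ) := fun N m => (TopologicalSpace.denseSeq (E N) m : C(K, ℝ))
  have hdE : ∀ N m, Function.support (d N m) ⊆ Metric.closedBall o N :=
    fun N m => (TopologicalSpace.denseSeq (E N) m).2
  have hbound : ∀ p : ℕ × ℕ, ∃ c : ℝ, ∀ n, |∫ x, d p.1 p.2 x ∂(ν n)| ≤ c := by
    rintro ⟨N, m⟩
    obtain ⟨c, hc⟩ := (isCompact_closedBall o (N : ℝ)).exists_bound_of_continuousOn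
      (d N m).continuous.continuousOn
    refine ⟨max c 0 * C N, fun n => ?_⟩
    have := abs_integral_sub_integral_le o N (ν n) (d N m).continuous (g := fun _ => 0)
      continuous_const (hdE N m) (by simp) (δ := max c 0)
      (fun x hx => by simpa using Or.inl (hc x hx))
    simp only [integral_zero, sub_zero] at this
    exact this.trans (mul_le_mul_of_nonneg_left (hC _ _) (le_max_right _ _))
  choose c hc using hbound
  -- Compactness of a countable product of intervals replaces the diagonal extraction.
  have hcpt : IsCompact (Set.pi Set.univ fun p : ℕ × ℕ => Set.Icc (-c p) (c p)) :=
    isCompact_univ_pi fun p => isCompact_Icc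
  obtain ⟨a, -, t, ht, hlim⟩ := hcpt.tendsto_subseq
    (x := fun n (p : ℕ × ℕ) => ∫ x, d p.1 p.2 x ∂(ν n))
    (fun n p _ => abs_le.mp (hc p n))
  rw [tendsto_pi_nhds] at hlim
  refine ⟨t, ht, fun f hf hfs => ?_⟩
  obtain ⟨N, hN⟩ : ∃ N : ℕ, Function.support f ⊆ Metric.closedBall o N := by
    obtain ⟨r, hr⟩ := hfs.isCompact.isBounded.subset_closedBall o
    obtain ⟨N, hN⟩ := exists_nat_ge r
    exact ⟨N, (subset_tsupport f).trans (hr.trans (Metric.closedBall_subset_closedBall hN))⟩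
  rw [Metric.cauchySeq_iff']
  intro δ hδ
  obtain ⟨η, hη, hηδ⟩ : ∃ η > 0, η * C N < δ / 4 := by
    refine ⟨δ / 4 / (C N + 1), by have := hC0 N; positivity, ?_⟩
    rw [div_mul_eq_mul_div, div_lt_iff₀ (by have := hC0 N; positivity)]
    have := hC0 N
    nlinarith
  obtain ⟨m, hm⟩ : ∃ m, ∀ x ∈ Metric.closedBall o (N : ℝ), |f x - d N m x| ≤ η := by
    let F : E N := ⟨⟨f, hf⟩, hN⟩
    have hev : ∀ᶠ g : C(K, ℝ) in 𝓝 (F : C(K, ℝ)), ∀ x ∈ Metric.closedBall o (N : ℝ),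
        dist (f x) (g x) < η :=
      Metric.tendstoUniformlyOn_iff.mp
        (ContinuousMap.tendsto_iff_forall_isCompact_tendstoUniformlyOn.mp tendsto_id _
          (isCompact_closedBall o (N : ℝ))) η hη
    have hev' := (continuous_subtype_val.tendsto F).eventually hev
    obtain ⟨m, hm⟩ := (TopologicalSpace.denseRange_denseSeq (E N)).exists_mem_open
      isOpen_interior ⟨F, mem_interior_iff_mem_nhds.mpr hev'⟩
    exact ⟨m, fun x hx => le_of_lt (interior_subset hm x hx)⟩
  have hclose : ∀ n, |∫ x, f x ∂(ν n) - ∫ x, d N m x ∂(ν n)| < δ / 4 := fun n =>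
    ((abs_integral_sub_integral_le o N (ν n) hf (d N m).continuous hN (hdE N m) hm).trans
      (mul_le_mul_of_nonneg_left (hC N n) hη.le)).trans_lt hηδ
  obtain ⟨n₀, hn₀⟩ := Metric.tendsto_atTop.mp (hlim (N, m)) (δ / 4) (by positivity)
  refine ⟨n₀, fun n hn => ?_⟩
  have h1 := hclose (t n)
  have h2 := hclose (t n₀)
  have h3 := hn₀ n hn
  have h4 := hn₀ n₀ le_rfl
  rw [Real.dist_eq] at h3 h4 ⊢
  simp only [Function.comp] at h3 h4
  rw [abs_lt] at *
  constructor <;> linarith [h1.1, h1.2, h2.1, h2.2, h3.1, h3.2, h4.1, h4.2]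

/-- A sequence of measures on a proper metric space that is bounded on balls has a vaguely
convergent subsequence. -/
theorem exists_subseq_tendsto_integral {K : Type v} [MetricSpace K] [ProperSpace K]
    [MeasurableSpace K] [BorelSpace K] (o : K) (ν : ℕ → Measure K)
    [∀ n, IsFiniteMeasureOnCompacts (ν n)]
    (hb : ∀ R : ℝ, ∃ C : ℝ, ∀ n, (ν n).real (Metric.closedBall o R) ≤ C) :
    ∃ t : ℕ → ℕ, StrictMono t ∧ ∃ μ : Measure K, IsFiniteMeasureOnCompacts μ ∧
      ∀ f : K → ℝ, Continuous f → HasCompactSupport f →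
        Tendsto (fun n => ∫ x, f x ∂(ν (t n))) atTop (𝓝 (∫ x, f x ∂μ)) := by
  obtain ⟨t, ht, hcau⟩ := exists_subseq_cauchySeq_integral o ν hb
  have hlim : ∀ f : C_c(K, ℝ), ∃ l, Tendsto (fun n => ∫ x, f x ∂(ν (t n))) atTop (𝓝 l) :=
    fun f => cauchySeq_tendsto_of_complete (hcau f f.continuous f.hasCompactSupport)
  choose l hl using hlim
  have hint : ∀ (f : C_c(K, ℝ)) n, Integrable f (ν n) := fun f n =>
    f.continuous.integrable_of_hasCompactSupport f.hasCompactSupport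
  let L : C_c(K, ℝ) →ₗ[ℝ] ℝ :=
    { toFun := l
      map_add' := fun f g => tendsto_nhds_unique (hl (f + g)) <| by
        refine ((hl f).add (hl g)).congr fun n => ?_
        rw [← integral_add (hint f _) (hint g _)]
        rfl
      map_smul' := fun c f => tendsto_nhds_unique (hl (c • f)) <| by
        refine ((hl f).const_smul c).congr fun n => ?_
        rw [← integral_smul]
        rfl }
  -- The limit functional is positive, so Riesz–Markov–Kakutani represents it by a measure.
  let Λ := PositiveLinearMap.mk₀ L fun f hf =>
    ge_of_tendsto' (hl f) fun n => integral_nonneg (show (0 : K → ℝ) ≤ f from hf)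
  refine ⟨t, ht, RealRMK.rieszMeasure Λ, inferInstance, fun f hf hfs => ?_⟩
  have := RealRMK.integral_rieszMeasure Λ ⟨⟨f, hf⟩, hfs⟩
  have h2 := hl ⟨⟨f, hf⟩, hfs⟩
  simp only [CompactlySupportedContinuousMap.coe_mk, ContinuousMap.coe_mk] at this h2
  rw [this]
  exact h2

end Vague

/-! ### Uniformly distributed measures on a group -/

section UniformlyDistributed

/-- Fubini on the pairs `(x, y)` with `x ∈ C` and `dist y x < r`: the slice over `x ∈ C` is an
`r`-ball, of `ν`-measure `b`; the slice over `y` lies in an `r`-ball, of `μ`-measure `a`, and is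
empty off the thickening. -/
theorem mul_measure_le_mul_measure_thickening {K : Type v} [MetricSpace K]
    [SecondCountableTopology K] [MeasurableSpace K] [BorelSpace K] (μ ν : Measure K)
    [SFinite μ] [SFinite ν] {r : ℝ} {a b : ENNReal}
    (hμ : ∀ x, μ (Metric.ball x r) = a) (hν : ∀ x, ν (Metric.ball x r) = b)
    {C : Set K} (hC : MeasurableSet C) :
    b * μ C ≤ a * ν (Metric.thickening r C) := by
  let S : Set (K × K) := {p | p.1 ∈ C ∧ dist p.2 p.1 < r}
  have hS : MeasurableSet S := (measurable_fst hC).inter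
    (isOpen_lt (continuous_snd.dist continuous_fst) continuous_const).measurableSet
  have h1 : (μ.prod ν) S = b * μ C := by
    rw [Measure.prod_apply hS, ← setLIntegral_const, ← lintegral_indicator hC]
    refine lintegral_congr fun x => ?_
    by_cases hx : x ∈ C
    · rw [Set.indicator_of_mem hx, ← hν x]
      congr 1
      ext y
      simp [S, hx]
    · rw [Set.indicator_of_notMem hx]
      convert measure_empty (μ := ν)
      ext y
      simp [S, hx]
  rw [← h1, Measure.prod_apply_symm hS, ← setLIntegral_const,
    ← lintegral_indicator Metric.isOpen_thickening.measurableSet]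
  refine lintegral_mono fun y => ?_
  by_cases hy : y ∈ Metric.thickening r C
  · rw [Set.indicator_of_mem hy, ← hμ y]
    refine measure_mono fun x hx => ?_
    have := hx.2
    rwa [Metric.mem_ball, dist_comm]
  · rw [Set.indicator_of_notMem hy]
    refine le_of_eq ?_
    convert measure_empty (μ := μ)
    ext x
    simp only [S, Set.mem_preimage, Set.mem_ofPred_eq, Set.mem_empty_iff_false, iff_false]
    exact fun h => hy (Metric.mem_thickening_iff.mpr ⟨x, h.1, h.2⟩)

variable {K : Type v} [Group K] [MetricSpace K] [ProperSpace K] [IsTopologicalGroup K]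
  [IsIsometricSMul K K] [MeasurableSpace K] [BorelSpace K]

theorem preimage_mul_left_thickening {K : Type v} [Group K] [MetricSpace K]
    [IsIsometricSMul K K] (k : K) (r : ℝ) (C : Set K) :
    Metric.thickening r ((k * ·) ⁻¹' C) = (k * ·) ⁻¹' Metric.thickening r C := by
  ext x
  simp only [Metric.mem_thickening_iff, Set.mem_preimage]
  constructor
  · rintro ⟨z, hz, h⟩
    exact ⟨k * z, hz, by rwa [dist_mul_left]⟩
  · rintro ⟨z, hz, h⟩
    refine ⟨k⁻¹ * z, by simpa using hz, ?_⟩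
    rwa [← dist_mul_left k, mul_inv_cancel_left]

/-- If balls of equal radius have equal measure, translating a compact set does not increase
its measure. -/
theorem measure_preimage_mul_left_le_of_ball (μ : Measure K) [IsFiniteMeasureOnCompacts μ]
    (hμ : ∀ x y r, μ (Metric.ball x r) = μ (Metric.ball y r)) (k : K) {C : Set K}
    (hC : IsCompact C) : μ ((k * ·) ⁻¹' C) ≤ μ C := by
  let ν : Measure K := Measure.haar
  have hν : ∀ x r, ν (Metric.ball x r) = ν (Metric.ball 1 r) := by
    intro x r
    rw [← measure_preimage_mul ν x (Metric.ball x r)]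
    congr 1
    ext y
    simp only [Set.mem_preimage, Metric.mem_ball]
    rw [← dist_mul_left x⁻¹]
    simp
  -- Pass from `μ` to `ν` and back, each passage costing a thickening by `r`; in between, invariance
  -- of `ν` removes the translation. Only the `ν`-measure of a ball is cancelled, so `μ` may vanish.
  have key : ∀ r > 0, μ ((k * ·) ⁻¹' C) ≤ μ (Metric.cthickening (2 * r) C) := by
    intro r hr
    have hpos : ν (Metric.ball (1 : K) r) ≠ 0 :=
      (Metric.isOpen_ball.measure_pos ν ⟨1, Metric.mem_ball_self hr⟩).ne'
    have hfin : ν (Metric.ball (1 : K) r) ≠ ⊤ := measure_ball_lt_top.ne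
    have hCm : MeasurableSet ((k * ·) ⁻¹' C) := measurable_const_mul k hC.measurableSet
    have h1 := mul_measure_le_mul_measure_thickening μ ν (fun x => hμ x 1 r) (fun x => hν x r) hCm
    have h2 := mul_measure_le_mul_measure_thickening ν μ (fun x => hν x r) (fun x => hμ x 1 r)
      (Metric.isOpen_thickening (δ := r) (E := C)).measurableSet
    rw [preimage_mul_left_thickening, measure_preimage_mul ν] at h1
    refine (ENNReal.mul_le_mul_iff_right hpos hfin).mp (h1.trans (h2.trans ?_))
    gcongr
    refine (Metric.thickening_thickening_subset r r C).trans ?_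
    rw [← two_mul]
    exact Metric.thickening_subset_cthickening _ _
  have hlim : Tendsto (fun r : ℝ => μ (Metric.cthickening (2 * r) C)) (𝓝[>] 0) (𝓝 (μ C)) := by
    refine (tendsto_measure_cthickening_of_isCompact hC).comp
      (tendsto_nhdsWithin_of_tendsto_nhds ?_)
    have : Continuous fun r : ℝ => 2 * r := by fun_prop
    simpa using this.tendsto 0
  exact ge_of_tendsto hlim (eventually_mem_nhdsWithin.mono fun r hr => key r hr)

/-- On a proper group with left invariant metric, a measure for which balls of equal radius have
equal measure is left invariant. -/
theorem isMulLeftInvariant_of_measure_ball_eq (μ : Measure K) [IsFiniteMeasureOnCompacts μ]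
    (hμ : ∀ x y r, μ (Metric.ball x r) = μ (Metric.ball y r)) : μ.IsMulLeftInvariant := by
  have hle := fun k (C : Set K) (hC : IsCompact C) =>
    measure_preimage_mul_left_le_of_ball μ hμ k hC
  refine ⟨fun k => ?_⟩
  have : IsFiniteMeasureOnCompacts (μ.map (k * ·)) :=
    Measure.IsFiniteMeasureOnCompacts.map μ (Homeomorph.mulLeft k)
  apply Measure.OuterRegular.ext_isOpen
  apply Measure.InnerRegularWRT.eq_of_innerRegularWRT_of_forall_eq Measure.Regular.innerRegular
    Measure.Regular.innerRegular
  intro C hC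
  rw [Measure.map_apply (measurable_const_mul k) hC.measurableSet]
  refine le_antisymm (hle k C hC) ?_
  have hD : IsCompact ((k * ·) ⁻¹' C) := (Homeomorph.mulLeft k).isCompact_preimage.mpr hC
  have := hle k⁻¹ _ hD
  rwa [← Set.preimage_comp, show ((k * ·) ∘ (k⁻¹ * ·) : K → K) = id by ext; simp,
    Set.preimage_id] at this

end UniformlyDistributed

/-! ### Radial cutoffs -/

section Cutoff

/-- There is a Lipschitz function on the line which is `1` up to `s` and `0` from `r` on. -/
theorem exists_lipschitz_cutoff {s r : ℝ} (h : s < r) :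
    ∃ (L : NNReal) (F : ℝ → ℝ), LipschitzWith L F ∧ (∀ t, 0 ≤ F t) ∧ (∀ t, F t ≤ 1) ∧
      (∀ t ≤ s, F t = 1) ∧ ∀ t, r ≤ t → F t = 0 := by
  have hrs : 0 < r - s := sub_pos.mpr h
  refine ⟨(1 / (r - s)).toNNReal, fun t => max 0 (min 1 ((1 / (r - s)) * (r - t))), ?_,
    fun t => le_max_left _ _, fun t => max_le zero_le_one (min_le_left _ _), ?_, ?_⟩
  · refine (LipschitzWith.const_min ?_ 1).const_max 0
    refine LipschitzWith.of_dist_le_mul fun a b => ?_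
    rw [Real.dist_eq, Real.dist_eq, ← mul_sub, abs_mul, abs_of_pos (by positivity),
      Real.coe_toNNReal _ (by positivity), abs_sub_comm a b]
    apply le_of_eq
    ring_nf
  · intro t ht
    have : 1 ≤ (1 / (r - s)) * (r - t) := by
      rw [one_div_mul_eq_div, one_le_div hrs]
      linarith
    beta_reduce
    rw [min_eq_left this, max_eq_right zero_le_one]
  · intro t ht
    have : (1 / (r - s)) * (r - t) ≤ 0 :=
      mul_nonpos_of_nonneg_of_nonpos (by positivity) (by linarith)
    exact max_eq_left ((min_le_right _ _).trans this)

theorem hasCompactSupport_comp_dist {K : Type v} [MetricSpace K] [ProperSpace K] {F : ℝ → ℝ} {M : ℝ} (hF : ∀ t, M ≤ t → F t = 0) (x : K) :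
    HasCompactSupport fun k => F (dist x k) :=
  HasCompactSupport.of_support_subset_isCompact (isCompact_closedBall x M) fun k hk => by
    by_contra hk'
    rw [Metric.mem_closedBall, dist_comm, not_le] at hk'
    exact hk (hF _ hk'.le)

variable {K : Type v} [MetricSpace K] [ProperSpace K] [MeasurableSpace K] [BorelSpace K]

theorem measureReal_closedBall_le_integral_comp_dist (μ : Measure K)
    [IsFiniteMeasureOnCompacts μ] {F : ℝ → ℝ} {s r : ℝ} (hFc : Continuous F)
    (h0 : ∀ t, 0 ≤ F t) (hs : ∀ t ≤ s, F t = 1) (hr : ∀ t, r ≤ t → F t = 0) (x : K) :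
    μ.real (Metric.closedBall x s) ≤ ∫ k, F (dist x k) ∂μ := by
  rw [← integral_indicator_one Metric.isClosed_closedBall.measurableSet]
  refine integral_mono ?_ ?_ fun k => ?_
  · rw [integrable_indicator_iff Metric.isClosed_closedBall.measurableSet]
    exact integrableOn_const (isCompact_closedBall x s).measure_lt_top.ne
  · exact Continuous.integrable_of_hasCompactSupport (by fun_prop)
      (hasCompactSupport_comp_dist hr x)
  · by_cases hk : k ∈ Metric.closedBall x s
    · rw [Set.indicator_of_mem hk, hs _ (by rwa [dist_comm])]
      rfl
    · rw [Set.indicator_of_notMem hk]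
      exact h0 _

theorem integral_comp_dist_le_measureReal_ball (μ : Measure K)
    [IsFiniteMeasureOnCompacts μ] {F : ℝ → ℝ} {r : ℝ} (hFc : Continuous F)
    (h1 : ∀ t, F t ≤ 1) (hr : ∀ t, r ≤ t → F t = 0) (x : K) :
    ∫ k, F (dist x k) ∂μ ≤ μ.real (Metric.ball x r) := by
  rw [← integral_indicator_one Metric.isOpen_ball.measurableSet]
  refine integral_mono ?_ ?_ fun k => ?_
  · exact Continuous.integrable_of_hasCompactSupport (by fun_prop)
      (hasCompactSupport_comp_dist hr x)
  · rw [integrable_indicator_iff Metric.isOpen_ball.measurableSet]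
    exact integrableOn_const measure_ball_lt_top.ne
  · by_cases hk : k ∈ Metric.ball x r
    · rw [Set.indicator_of_mem hk]
      exact h1 _
    · rw [Set.indicator_of_notMem hk]
      rw [Metric.mem_ball, dist_comm, not_lt] at hk
      exact (hr _ hk).le

/-- A compact subset of an open `r`-ball lies in a concentric ball of radius `s < r`, so a Lipschitz
cutoff between `s` and `r` and inner regularity compare the two measures. -/
theorem measure_ball_le_of_integral_comp_dist_eq (μ : Measure K) [IsFiniteMeasureOnCompacts μ]
    {x y : K} (h : ∀ (L : NNReal) (F : ℝ → ℝ) (M : ℝ), LipschitzWith L F →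
      (∀ t, M ≤ t → F t = 0) → ∫ k, F (dist x k) ∂μ = ∫ k, F (dist y k) ∂μ) (r : ℝ) :
    μ (Metric.ball x r) ≤ μ (Metric.ball y r) := by
  rw [Metric.isOpen_ball.measure_eq_iSup_isCompact]
  refine iSup₂_le fun C hC => iSup_le fun hCc => ?_
  obtain ⟨s, hs, hCs⟩ := exists_lt_subset_ball hCc.isClosed hC
  obtain ⟨L, F, hL, h0, h1, hFs, hFr⟩ := exists_lipschitz_cutoff hs
  refine (measure_mono (hCs.trans Metric.ball_subset_closedBall)).trans ?_
  have h2 := (measureReal_closedBall_le_integral_comp_dist μ hL.continuous h0 hFs hFr x).trans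
    ((h L F r hL hFr).trans_le (integral_comp_dist_le_measureReal_ball μ hL.continuous h1 hFr y))
  exact (ENNReal.toReal_le_toReal (isCompact_closedBall x s).measure_lt_top.ne
    measure_ball_lt_top.ne).mp h2

end Cutoff

/-! ### Consequences of pointed measured convergence of groups -/

theorem bddAbove_of_eventually_le {u : ℕ → ℝ} {c : ℝ} (h : ∀ᶠ n in atTop, u n ≤ c) :
    ∃ C, ∀ n, u n ≤ C := by
  obtain ⟨C, hC⟩ := Filter.IsBoundedUnder.bddAbove_range (f := u) ⟨c, h⟩
  exact ⟨C, fun n => hC ⟨n, rfl⟩⟩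

theorem ENNReal.iInf_pos_of_eventually_le {u : ℕ → ENNReal} {c : ENNReal} (hc : 0 < c)
    (hu : ∀ n, 0 < u n) (h : ∀ᶠ n in atTop, c ≤ u n) : 0 < ⨅ n, u n := by
  obtain ⟨N, hN⟩ := eventually_atTop.mp h
  have h1 : 0 < min c ((Finset.range N).inf u) :=
    lt_min hc ((Finset.lt_inf_iff ENNReal.zero_lt_top).mpr fun n _ => hu n)
  refine h1.trans_le (le_iInf fun n => ?_)
  rcases lt_or_ge n N with hn | hn
  · exact (min_le_right _ _).trans (Finset.inf_le (Finset.mem_range.mpr hn))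
  · exact (min_le_left _ _).trans (hN n hn)

theorem setOf_dist_le_eq_closedBall {K : Type v} [MetricSpace K] (x : K) (r : ℝ) :
    {g | dist x g ≤ r} = Metric.closedBall x r := by
  ext g
  rw [Metric.mem_closedBall, dist_comm]
  rfl

theorem integrableOn_of_measurable_of_bound {Y : Type u} [MeasurableSpace Y] {μ : Measure Y}
    {S : Set Y} (hS : μ S < ⊤) {f : Y → ℝ} (hf : Measurable f) {c : ℝ} (hc : ∀ y, |f y| ≤ c) :
    IntegrableOn f S μ :=
  Measure.integrableOn_of_bounded hS.ne hf.aestronglyMeasurable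
    (ae_of_all _ fun y => hc y)

theorem LipschitzWith.abs_le_of_eq_zero {L : NNReal} {F : ℝ → ℝ} {M : ℝ} (hF : LipschitzWith L F)
    (hM : ∀ t, M ≤ t → F t = 0) {t : ℝ} (ht : 0 ≤ t) : |F t| ≤ L * |M| := by
  have h := hF.dist_le_mul t (max M t)
  rw [hM _ (le_max_left _ _), Real.dist_eq, sub_zero, Real.dist_eq] at h
  refine h.trans (mul_le_mul_of_nonneg_left ?_ L.2)
  rcases le_total M t with h' | h'
  · simp [h']
  · rw [max_eq_left h', abs_sub_comm, abs_of_nonneg (sub_nonneg.mpr h'),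
      abs_of_nonneg (ht.trans h')]
    linarith

section PMGH

variable {H : ℕ → Type u} [∀ j, Group (H j)] [∀ j, MetricSpace (H j)] [∀ j, ProperSpace (H j)]
  [∀ j, MeasurableSpace (H j)] [∀ j, BorelSpace (H j)]
  {K : Type v} [Group K] [MetricSpace K] [ProperSpace K] [MeasurableSpace K] [BorelSpace K]
  {μ : ∀ j, Measure (H j)} {μK : Measure K}

theorem PMGHConverges.exists_measureReal_closedBall_le [∀ j, IsFiniteMeasureOnCompacts (μ j)]
    (h : PMGHConverges (fun j (g h : H j) => dist g h) μ (fun g h : K => dist g h) μK) (r : ℝ) :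
    ∃ C : ℝ, ∀ j, (μ j).real (Metric.closedBall 1 r) ≤ C := by
  obtain ⟨-, R, ε, ψ, hR, hε, hψ, hψ1, hiso, -, hint⟩ := h
  -- The cutoff is `1` up to `r + 1` because `ψ j` may increase the distance to the identity by up
  -- to `ε j < 1`.
  obtain ⟨L, F, hL, h0, h1, hFs, hFr⟩ := exists_lipschitz_cutoff (lt_add_one (r + 1))
  have hlim := hint (fun k => F (dist 1 k)) (hL.continuous.comp (by fun_prop))
    (hasCompactSupport_comp_dist hFr 1)
  refine bddAbove_of_eventually_le (c := (∫ k, F (dist 1 k) ∂μK) + 1) ?_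
  filter_upwards [hR.eventually_ge_atTop r, hR.eventually_ge_atTop 0,
    hε.eventually (gt_mem_nhds zero_lt_one),
    hlim.eventually (gt_mem_nhds (lt_add_one _))] with j hj hj0 hj1 hj2
  refine le_trans ?_ hj2.le
  rw [setOf_dist_le_eq_closedBall]
  have hsub : Metric.closedBall (1 : H j) r ⊆ Metric.closedBall 1 (R j) :=
    Metric.closedBall_subset_closedBall hj
  have hm : Measurable fun g : H j => F (dist 1 (ψ j g)) :=
    hL.continuous.measurable.comp (measurable_const.dist (hψ j))
  have hb : ∀ g : H j, |F (dist 1 (ψ j g))| ≤ 1 := fun g => by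
    rw [abs_of_nonneg (h0 _)]
    exact h1 _
  calc (μ j).real (Metric.closedBall 1 r)
      = ∫ g in Metric.closedBall (1 : H j) r, (1 : ℝ) ∂(μ j) := by simp
    _ ≤ ∫ g in Metric.closedBall (1 : H j) r, F (dist 1 (ψ j g)) ∂(μ j) := by
        refine setIntegral_mono_on
          (integrableOn_const (isCompact_closedBall _ _).measure_lt_top.ne)
          (integrableOn_of_measurable_of_bound (isCompact_closedBall _ _).measure_lt_top hm hb)
          Metric.isClosed_closedBall.measurableSet fun g hg => ?_
        rw [Metric.mem_closedBall, dist_comm] at hg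
        have := hiso j 1 g (by simpa using hj0) (hg.trans hj)
        rw [hψ1] at this
        exact (hFs _ (by linarith [(abs_lt.mp this).1])).ge
    _ ≤ _ := setIntegral_mono_set
        (integrableOn_of_measurable_of_bound (isCompact_closedBall _ _).measure_lt_top hm hb)
        (ae_of_all _ fun g => h0 _) hsub.eventuallyLE

/-- Radial integrals about the identity converge to the radial integral about any point of
the limit. -/
theorem PMGHConverges.tendsto_integral_comp_dist [∀ j, IsTopologicalGroup (H j)]
    [∀ j, IsIsometricSMul (H j) (H j)]
    [∀ j, IsFiniteMeasureOnCompacts (μ j)] [∀ j, (μ j).IsMulLeftInvariant]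
    (h : PMGHConverges (fun j (g h : H j) => dist g h) μ (fun g h : K => dist g h) μK)
    {L : NNReal} {F : ℝ → ℝ} {M : ℝ} (hF : LipschitzWith L F) (hM : ∀ t, M ≤ t → F t = 0)
    (x : K) :
    Tendsto (fun j => ∫ g, F (dist 1 g) ∂(μ j)) atTop (𝓝 (∫ k, F (dist x k) ∂μK)) := by
  have hbdd := h.exists_measureReal_closedBall_le
  obtain ⟨-, R, ε, ψ, hR, hε, hψ, hψ1, hiso, hcov, hint⟩ := h
  beta_reduce at hiso hcov
  set D := dist 1 x with hD
  have hD0 : 0 ≤ D := dist_nonneg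
  -- Chosen so that both integrands, centred at `x` (through `ψ j`) and at its approximate preimage
  -- `a`, vanish outside the `M'`-ball: `ψ j` costs less than `1`, and `a` is within `D + 2` of the
  -- identity.
  set M' := max M 0 + D + 4 with hM'
  obtain ⟨C, hC⟩ := hbdd M'
  have hlim := hint (fun k => F (dist x k)) (hF.continuous.comp (by fun_prop))
    (hasCompactSupport_comp_dist hM x)
  refine tendsto_of_tendsto_of_dist hlim ?_
  have hε' : Tendsto (fun j => L * (2 * ε j) * C) atTop (𝓝 0) := by
    simpa using ((hε.const_mul 2).const_mul (L : ℝ)).mul_const C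
  refine squeeze_zero' (Eventually.of_forall fun _ => dist_nonneg) ?_ hε'
  filter_upwards [hR.eventually_ge_atTop M', hε.eventually (gt_mem_nhds zero_lt_one)] with j hj hj1
  have hR0 : (0 : ℝ) ≤ R j := le_trans (by positivity) hj
  have hε0 : 0 < ε j := (abs_nonneg _).trans_lt (hiso j 1 1 (by simpa using hR0) (by simpa using hR0))
  have hM0 : 0 ≤ max M 0 := le_max_right _ _
  have hMM : M ≤ max M 0 := le_max_left _ _
  obtain ⟨a, haR, ha⟩ := hcov j x (by rw [← hD]; linarith)
  have haD : dist 1 a ≤ D + 2 := by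
    have h1 := hiso j 1 a (by simpa using hR0) haR
    rw [hψ1] at h1
    have h2 := dist_triangle 1 x (ψ j a)
    linarith [(abs_lt.mp h1).2]
  set T := Metric.closedBall (1 : H j) M' with hT
  have hTm : MeasurableSet T := Metric.isClosed_closedBall.measurableSet
  have hTfin : (μ j) T < ⊤ := (isCompact_closedBall _ _).measure_lt_top
  have hmem : ∀ g : H j, g ∈ T ↔ dist 1 g ≤ M' := fun g => by
    rw [hT, Metric.mem_closedBall, dist_comm]
  -- both integrals are over `T`
  have e1 : ∫ g in {g : H j | dist 1 g ≤ R j}, F (dist x (ψ j g)) ∂(μ j) =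
      ∫ g in T, F (dist x (ψ j g)) ∂(μ j) := by
    rw [setOf_dist_le_eq_closedBall]
    refine setIntegral_eq_of_subset_of_forall_sdiff_eq_zero
      Metric.isClosed_closedBall.measurableSet
      (Metric.closedBall_subset_closedBall hj) fun g hg => hM _ ?_
    have hgR : dist 1 g ≤ R j := by rw [dist_comm]; exact hg.1
    have hgM : M' < dist 1 g := not_le.mp fun h => hg.2 ((hmem g).mpr h)
    have h1 := hiso j 1 g (by simpa using hR0) hgR
    rw [hψ1] at h1
    have h2 := dist_triangle 1 x (ψ j g)
    linarith [(abs_lt.mp h1).2]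
  have e2 : ∫ g, F (dist 1 g) ∂(μ j) = ∫ g in T, F (dist a g) ∂(μ j) := by
    -- Translation moves the centre from the identity to `a`; this is where invariance of the
    -- measure and of the metric enters.
    rw [← integral_mul_left_eq_self (fun g => F (dist 1 g)) a⁻¹]
    have : ∀ g : H j, dist 1 (a⁻¹ * g) = dist a g := fun g => by
      rw [← dist_mul_left a, mul_one, mul_inv_cancel_left]
    simp only [this]
    refine (setIntegral_eq_integral_of_forall_compl_eq_zero fun g hg => hM _ ?_).symm
    rw [hmem, not_le] at hg
    have h2 := dist_triangle 1 a g
    linarith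
  rw [e1, e2, dist_eq_norm, ← integral_sub]
  -- One `ε j` comes from `ψ j a` replacing `x`, the other from the distortion of `ψ j`.
  · refine (norm_setIntegral_le_of_norm_le_const (C := L * (2 * ε j)) hTfin fun g hg => ?_).trans
      (mul_le_mul_of_nonneg_left (hC j) (by positivity))
    rw [← dist_eq_norm]
    refine (hF.dist_le_mul _ _).trans (mul_le_mul_of_nonneg_left ?_ L.2)
    have h1 := hiso j a g haR (((hmem g).mp hg).trans hj)
    have h2 := dist_triangle x (ψ j a) (ψ j g)
    have h3 := dist_triangle_left (ψ j a) (ψ j g) x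
    rw [abs_lt] at h1
    rw [Real.dist_eq, abs_le]
    constructor <;> linarith [h1.1, h1.2]
  · exact integrableOn_of_measurable_of_bound hTfin
      (hF.continuous.measurable.comp (measurable_const.dist (hψ j)))
      fun g => hF.abs_le_of_eq_zero hM dist_nonneg
  · exact integrableOn_of_measurable_of_bound hTfin
      (hF.continuous.measurable.comp (measurable_const.dist measurable_id))
      fun g => hF.abs_le_of_eq_zero hM dist_nonneg

variable [∀ j, IsTopologicalGroup (H j)] [∀ j, IsIsometricSMul (H j) (H j)]
  [IsTopologicalGroup K] [IsIsometricSMul K K]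

/-- The same sequence of radial integrals about the identity converges to the radial integral about
every point of the limit, so uniqueness of limits makes the latter independent of the point. -/
theorem PMGHConverges.isMulLeftInvariant
    [∀ j, IsFiniteMeasureOnCompacts (μ j)] [∀ j, (μ j).IsMulLeftInvariant]
    (h : PMGHConverges (fun j (g h : H j) => dist g h) μ (fun g h : K => dist g h) μK) :
    μK.IsMulLeftInvariant := by
  have := h.1
  have hle : ∀ x y r, μK (Metric.ball x r) ≤ μK (Metric.ball y r) := fun x y r =>
    measure_ball_le_of_integral_comp_dist_eq μK (fun L F M hL hM =>
      tendsto_nhds_unique (h.tendsto_integral_comp_dist hL hM x)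
        (h.tendsto_integral_comp_dist hL hM y)) r
  exact isMulLeftInvariant_of_measure_ball_eq μK fun x y r => le_antisymm (hle x y r) (hle y x r)

theorem PMGHConverges.isHaarMeasure_iff [∀ j, (μ j).IsHaarMeasure]
    (h : PMGHConverges (fun j (g h : H j) => dist g h) μ (fun g h : K => dist g h) μK) :
    μK.IsHaarMeasure ↔ ∀ r : ℝ, 0 < r → 0 < ⨅ j, μ j (Metric.closedBall 1 r) := by
  have hfin := h.1
  have hinv := h.isMulLeftInvariant
  constructor
  · intro hHaar r hr
    obtain ⟨L, F, hL, h0, h1, hFs, hFr⟩ := exists_lipschitz_cutoff (half_lt_self hr)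
    have hlim := h.tendsto_integral_comp_dist hL hFr 1
    have hpos : 0 < ∫ k, F (dist 1 k) ∂μK := by
      refine lt_of_lt_of_le ?_
        (measureReal_closedBall_le_integral_comp_dist μK hL.continuous h0 hFs hFr 1)
      exact ENNReal.toReal_pos (Metric.measure_closedBall_pos μK 1 (half_pos hr)).ne'
        (isCompact_closedBall _ _).measure_lt_top.ne
    -- The limit only controls large `j`; the finitely many remaining balls have positive measure
    -- since each `μ j` is Haar.
    refine ENNReal.iInf_pos_of_eventually_le
      (c := ENNReal.ofReal ((∫ k, F (dist 1 k) ∂μK) / 2)) (by positivity)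
      (fun j => Metric.measure_closedBall_pos (μ j) 1 hr) ?_
    filter_upwards [hlim.eventually (lt_mem_nhds (half_lt_self hpos))] with j hj
    refine ENNReal.ofReal_le_of_le_toReal (hj.le.trans ?_)
    exact (integral_comp_dist_le_measureReal_ball (μ j) hL.continuous h1 hFr 1).trans
      (measureReal_mono Metric.ball_subset_closedBall (isCompact_closedBall _ _).measure_lt_top.ne)
  · intro hpos
    have hball : ∀ r > 0, 0 < μK (Metric.ball 1 r) := by
      intro r hr
      obtain ⟨L, F, hL, h0, h1, hFs, hFr⟩ := exists_lipschitz_cutoff (half_lt_self hr)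
      have hlim := h.tendsto_integral_comp_dist hL hFr 1
      set m := ⨅ j, μ j (Metric.closedBall 1 (r / 2)) with hm
      have hm0 : 0 < m := hpos _ (half_pos hr)
      have hle : ∀ j, m ≤ μ j (Metric.closedBall 1 (r / 2)) := fun j => iInf_le _ j
      have hfinj : ∀ j, μ j (Metric.closedBall 1 (r / 2)) < ⊤ := fun j =>
        (isCompact_closedBall _ _).measure_lt_top
      have hmr : 0 < m.toReal := ENNReal.toReal_pos hm0.ne' ((hle 0).trans_lt (hfinj 0)).ne
      have h2 : m.toReal ≤ ∫ k, F (dist 1 k) ∂μK := ge_of_tendsto' hlim fun j =>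
        (ENNReal.toReal_mono (hfinj j).ne (hle j)).trans
          (measureReal_closedBall_le_integral_comp_dist (μ j) hL.continuous h0 hFs hFr 1)
      have h3 := hmr.trans_le
        (h2.trans (integral_comp_dist_le_measureReal_ball μK hL.continuous h1 hFr 1))
      exact (ENNReal.toReal_pos_iff.mp h3).1
    have : μK.IsOpenPosMeasure := by
      refine ⟨fun U hU hne => ?_⟩
      obtain ⟨x, hx⟩ := hne
      obtain ⟨r, hr, hsub⟩ := Metric.isOpen_iff.mp hU x hx
      refine ((hball r hr).trans_le ((le_of_eq ?_).trans (measure_mono hsub))).ne'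
      rw [← measure_preimage_mul μK x (Metric.ball x r)]
      congr 1
      ext y
      simp only [Set.mem_preimage, Metric.mem_ball]
      rw [← dist_mul_left x, mul_one]
    exact { }

end PMGH

/-! ### Existence of convergent subsequences -/

section Existence

/-- `Φ` is an approximation of `K` by `H` on the ball of radius `M`, up to the error `δ`; it is
not required to be Borel. -/
structure IsBallApprox {H : Type u} {K : Type v} [One H] [One K] (dH : H → H → ℝ)
    (dK : K → K → ℝ) (M δ : ℝ) (Φ : H → K) : Prop where
  map_one : dK 1 (Φ 1) ≤ δ
  almost_isometry : ∀ g h, dH 1 g ≤ M → dH 1 h ≤ M → |dH g h - dK (Φ g) (Φ h)| ≤ δ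
  almost_surjective : ∀ k, dK 1 k ≤ M → ∃ g, dH 1 g ≤ dK 1 k + δ ∧ dK k (Φ g) ≤ δ

/-- An approximation can be made Borel and pointed by discretizing it. -/
theorem IsBallApprox.exists_measurable {H : Type u} {K : Type v} [One H] [One K]
    [MetricSpace H] [TopologicalSpace.SeparableSpace H] [MeasurableSpace H] [BorelSpace H]
    [MetricSpace K] [MeasurableSpace K] {Φ : H → K} {M δ ε : ℝ}
    (hδ : 0 < δ) (hδε : 5 * δ < ε)
    (h : IsBallApprox (fun g h : H => dist g h) (fun g h : K => dist g h) (M + ε) δ Φ) :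
    ∃ Ψ : H → K, Measurable Ψ ∧ Ψ 1 = 1 ∧
      (∀ g h : H, dist 1 g ≤ M → dist 1 h ≤ M → |dist g h - dist (Ψ g) (Ψ h)| < ε) ∧
      ∀ k : K, dist 1 k ≤ M - ε → ∃ g : H, dist 1 g ≤ M ∧ dist k (Ψ g) < ε := by
  classical
  obtain ⟨h1, hiso, hsurj⟩ := h
  have hex : ∀ g : H, ∃ n, dist g (TopologicalSpace.denseSeq H n) < δ := fun g =>
    (TopologicalSpace.denseRange_denseSeq H).exists_dist_lt g hδ
  -- Rounding to the first nearby point of a dense sequence makes `Φ ∘ p` Borel whatever `Φ` is.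
  let p : H → H := fun g => TopologicalSpace.denseSeq H (Nat.find (hex g))
  have hp : ∀ g, dist g (p g) < δ := fun g => Nat.find_spec (hex g)
  let Ψ : H → K := fun g => if g = 1 then 1 else Φ (p g)
  have hΨ : Measurable Ψ := by
    refine Measurable.ite (measurableSet_singleton 1) measurable_const ?_
    have hfind : Measurable fun g => Nat.find (hex g) :=
      measurable_find hex fun n =>
        (isOpen_lt (continuous_id.dist continuous_const) continuous_const).measurableSet
    exact (Measurable.of_discrete (f := fun n => Φ (TopologicalSpace.denseSeq H n))).comp hfind
  have hclose : ∀ g : H, dist 1 g ≤ M → dist (Ψ g) (Φ g) ≤ 2 * δ := by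
    intro g hg
    by_cases hg1 : g = 1
    · simp only [Ψ, hg1, if_true]
      linarith
    · simp only [Ψ, hg1, if_false]
      have h2 := hp g
      have h3 := dist_triangle 1 g (p g)
      have h4 := (abs_le.mp (hiso (p g) g (by linarith) (by linarith))).1
      rw [dist_comm (p g) g] at h4
      linarith
  refine ⟨Ψ, hΨ, by simp [Ψ], fun g h hg hh => ?_, fun k hk => ?_⟩
  -- Replacing `Φ` by `Ψ` costs `2 * δ` at each of the two points and `Φ` itself distorts by `δ`,
  -- whence `5 * δ < ε`.
  · have h2 := abs_le.mp (hiso g h (by linarith) (by linarith))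
    have h3 := hclose g hg
    have h4 := hclose h hh
    have h5 := abs_le.mp (abs_dist_sub_le (Ψ g) (Φ g) (Ψ h))
    have h6 := abs_le.mp (abs_dist_sub_le (Ψ h) (Φ h) (Φ g))
    rw [dist_comm (Ψ h) (Φ g), dist_comm (Φ h) (Φ g)] at h6
    rw [abs_lt]
    constructor <;> linarith [h2.1, h2.2, h5.1, h5.2, h6.1, h6.2]
  · obtain ⟨g, hg, hkg⟩ := hsurj k (by linarith)
    have hgM : dist 1 g ≤ M := by linarith
    refine ⟨g, hgM, ?_⟩
    have h3 := hclose g hgM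
    have h4 := dist_triangle_right k (Ψ g) (Φ g)
    linarith

variable {H : ℕ → Type u} [∀ j, Group (H j)] [∀ j, MetricSpace (H j)] [∀ j, ProperSpace (H j)]
  [∀ j, MeasurableSpace (H j)] [∀ j, BorelSpace (H j)]
  {K : Type v} [Group K] [MetricSpace K] [ProperSpace K] [MeasurableSpace K] [BorelSpace K]

theorem exists_subseq_pmghConverges (μ : ∀ j, Measure (H j))
    [∀ j, IsFiniteMeasureOnCompacts (μ j)]
    (hb : ∀ r : ℝ, ∃ C : ℝ, ∀ j, (μ j).real (Metric.closedBall 1 r) ≤ C)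
    (happ : ∀ M δ : ℝ, 0 ≤ M → 0 < δ → ∀ᶠ j in atTop, ∃ Φ : H j → K,
      IsBallApprox (fun g h : H j => dist g h) (fun g h : K => dist g h) M δ Φ) :
    ∃ t : ℕ → ℕ, StrictMono t ∧ ∃ μK : Measure K,
      PMGHConverges (fun k (g h : H (t k)) => dist g h) (fun k => μ (t k))
        (fun g h : K => dist g h) μK := by
  have hstep : ∀ n : ℕ, ∀ᶠ j in atTop, ∃ Ψ : H j → K, Measurable Ψ ∧ Ψ 1 = 1 ∧
      (∀ g h : H j, dist 1 g ≤ (n : ℝ) → dist 1 h ≤ (n : ℝ) →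
        |dist g h - dist (Ψ g) (Ψ h)| < 1 / ((n : ℝ) + 1)) ∧
      ∀ k : K, dist 1 k ≤ (n : ℝ) - 1 / ((n : ℝ) + 1) → ∃ g : H j, dist 1 g ≤ (n : ℝ) ∧
        dist k (Ψ g) < 1 / ((n : ℝ) + 1) := by
    intro n
    have hn : 0 < 1 / ((n : ℝ) + 1) := by positivity
    filter_upwards [happ (n + 1 / ((n : ℝ) + 1)) (1 / ((n : ℝ) + 1) / 6) (by positivity)
      (by positivity)]
      with j ⟨Φ, hΦ⟩
    exact hΦ.exists_measurable (by positivity) (by linarith)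
  obtain ⟨t₁, ht₁, hΨ⟩ := extraction_forall_of_eventually hstep
  choose Ψ hΨm hΨ1 hΨiso hΨcov using hΨ
  let S : ∀ n, Set (H (t₁ n)) := fun n => {g | dist 1 g ≤ (n : ℝ)}
  have hSm : ∀ n, MeasurableSet (S n) := fun n => by
    simp only [S, setOf_dist_le_eq_closedBall]
    exact Metric.isClosed_closedBall.measurableSet
  have hSfin : ∀ n, μ (t₁ n) (S n) < ⊤ := fun n => by
    simp only [S, setOf_dist_le_eq_closedBall]
    exact (isCompact_closedBall _ _).measure_lt_top
  -- Restricting to the ball used in the definition of convergence makes integrals against `ν n`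
  -- exactly the required test integrals.
  let ν : ℕ → Measure K := fun n => ((μ (t₁ n)).restrict (S n)).map (Ψ n)
  have hνfin : ∀ n, IsFiniteMeasure (ν n) := fun n => by
    have : IsFiniteMeasure ((μ (t₁ n)).restrict (S n)) :=
      ⟨by rw [Measure.restrict_apply_univ]; exact hSfin n⟩
    infer_instance
  have hνb : ∀ R : ℝ, ∃ C : ℝ, ∀ n, (ν n).real (Metric.closedBall 1 R) ≤ C := by
    intro R
    obtain ⟨C, hC⟩ := hb (R + 1)
    refine ⟨C, fun n => le_trans ?_ (hC (t₁ n))⟩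
    have hm : MeasurableSet (Metric.closedBall (1 : K) R) := Metric.isClosed_closedBall.measurableSet
    refine ENNReal.toReal_mono (isCompact_closedBall _ _).measure_lt_top.ne ?_
    rw [Measure.map_apply (hΨm n) hm, Measure.restrict_apply (hΨm n hm)]
    refine measure_mono fun g ⟨hg, hgS⟩ => ?_
    rw [Set.mem_preimage, Metric.mem_closedBall, dist_comm] at hg
    have h1 := hΨiso n 1 g (by simp) hgS
    rw [hΨ1] at h1
    have h2 : 1 / ((n : ℝ) + 1) ≤ 1 := by
      rw [div_le_one (by positivity)]
      linarith [n.cast_nonneg (α := ℝ)]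
    rw [Metric.mem_closedBall, dist_comm]
    linarith [(abs_lt.mp h1).2]
  obtain ⟨t₂, ht₂, μK, hμK, hlim⟩ := exists_subseq_tendsto_integral 1 ν hνb
  refine ⟨t₁ ∘ t₂, ht₁.comp ht₂, μK, hμK, fun n => (t₂ n : ℝ),
    fun n => 1 / ((t₂ n : ℝ) + 1), fun n => Ψ (t₂ n),
    tendsto_natCast_atTop_atTop.comp ht₂.tendsto_atTop,
    tendsto_one_div_add_atTop_nhds_zero_nat.comp ht₂.tendsto_atTop,
    fun n => hΨm _, fun n => hΨ1 _, fun n => hΨiso _, fun n => hΨcov _, fun f hf hfs => ?_⟩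
  refine (hlim f hf hfs).congr fun n => ?_
  exact integral_map (hΨm _).aemeasurable hf.aestronglyMeasurable

end Existence

/-! ### Topology of the isometry group -/

section IsometryGroupTopology

variable {X : Type u} [MetricSpace X]

/-- The inclusion of the isometry group into the space of continuous maps. -/
def isomToContinuousMap (g : X ≃ᵢ X) : C(X, X) := ⟨g, g.continuous⟩

theorem isInducing_isomToContinuousMap :
    IsInducing (isomToContinuousMap : (X ≃ᵢ X) → C(X, X)) := ⟨rfl⟩

theorem dist_inv_apply_inv_apply (g h : X ≃ᵢ X) (y : X) :
    dist (g⁻¹ y) (h⁻¹ y) = dist (h (h⁻¹ y)) (g (h⁻¹ y)) := by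
  rw [← g.dist_eq (g⁻¹ y)]
  congr 1
  rw [IsometryEquiv.apply_inv_self, IsometryEquiv.apply_inv_self]

variable [ProperSpace X]

theorem continuous_isom_apply : Continuous fun p : (X ≃ᵢ X) × X => p.1 p.2 :=
  (ContinuousEval.continuous_eval (F := C(X, X))).comp
    ((isInducing_isomToContinuousMap.continuous.comp continuous_fst).prodMk continuous_snd)

/-- The displacement between two inverses at `y` equals the displacement between the isometries
themselves at the fixed point `g⁻¹ y`, where evaluation is continuous. -/
theorem continuous_isom_inv_apply : Continuous fun p : (X ≃ᵢ X) × X => p.1⁻¹ p.2 := by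
  rw [continuous_iff_continuousAt]
  rintro ⟨g, y⟩
  rw [ContinuousAt, tendsto_iff_dist_tendsto_zero]
  have h : Continuous fun p : (X ≃ᵢ X) × X => dist p.2 y + dist (g (g⁻¹ y)) (p.1 (g⁻¹ y)) :=
    (continuous_snd.dist continuous_const).add (continuous_const.dist
      (continuous_isom_apply.comp (continuous_fst.prodMk continuous_const)))
  refine squeeze_zero (fun _ => dist_nonneg) (fun p => ?_) (by simpa using h.tendsto (g, y))
  have h1 := dist_triangle (p.1⁻¹ p.2) (p.1⁻¹ y) (g⁻¹ y)
  rwa [p.1⁻¹.dist_eq, dist_inv_apply_inv_apply p.1 g y, g.apply_inv_self] at h1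

instance isTopologicalGroup_isom : IsTopologicalGroup (X ≃ᵢ X) where
  continuous_mul := isInducing_isomToContinuousMap.continuous_iff.mpr <|
    ContinuousMap.continuous_of_continuous_uncurry _ <|
      continuous_isom_apply.comp ((continuous_fst.comp continuous_fst).prodMk
        (continuous_isom_apply.comp ((continuous_snd.comp continuous_fst).prodMk continuous_snd)))
  continuous_inv := isInducing_isomToContinuousMap.continuous_iff.mpr <|
    ContinuousMap.continuous_of_continuous_uncurry _ continuous_isom_inv_apply

/-- The isometries moving a point by a bounded amount form a compact set. -/
theorem isCompact_setOf_dist_apply_le (x : X) (ρ : ℝ) :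
    IsCompact {g : X ≃ᵢ X | dist (g x) x ≤ ρ} := by
  let S : Set C(X, X) := {f | LipschitzWith 1 f ∧ dist (f x) x ≤ ρ}
  have hScpt : IsCompact S := by
    refine ArzelaAscoli.isCompact_of_equicontinuous S ?_ ?_
    · have : ContinuousMap.toFun '' S = {f : X → X | LipschitzWith 1 f ∧ dist (f x) x ≤ ρ} := by
        ext f
        constructor
        · rintro ⟨f, hf, rfl⟩
          exact hf
        · intro hf
          exact ⟨⟨f, hf.1.continuous⟩, hf, rfl⟩
      rw [this]
      refine (isCompact_univ_pi fun y => isCompact_closedBall x (dist y x + ρ)).of_isClosed_subset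
        ?_ ?_
      · refine IsClosed.inter ?_ (isClosed_le
          ((continuous_apply x).dist continuous_const) continuous_const)
        exact isClosed_setOfPred_lipschitzWith 1
      · rintro f ⟨hf, hfx⟩ y -
        have h1 := hf.dist_le_mul y x
        rw [NNReal.coe_one, one_mul] at h1
        exact (dist_triangle _ (f x) _).trans (add_le_add h1 hfx)
    · exact (LipschitzWith.uniformEquicontinuous _ 1 fun f : S => f.2.1).equicontinuous
  -- Recording the inverse as well makes the image closed: being mutually inverse is a closed
  -- condition on pairs, and mutually inverse 1-Lipschitz maps are isometries.
  let Θ : (X ≃ᵢ X) → C(X, X) × C(X, X) := fun g => (isomToContinuousMap g, isomToContinuousMap g⁻¹)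
  have hΘc : Continuous Θ := isInducing_isomToContinuousMap.continuous.prodMk
    (isInducing_isomToContinuousMap.continuous.comp continuous_inv)
  have hΘ : IsInducing Θ := IsInducing.of_comp hΘc continuous_fst isInducing_isomToContinuousMap
  rw [hΘ.isCompact_iff]
  have himage : Θ '' {g : X ≃ᵢ X | dist (g x) x ≤ ρ} =
      (S ×ˢ S) ∩ {p | ∀ y, p.1 (p.2 y) = y ∧ p.2 (p.1 y) = y} := by
    ext ⟨f, k⟩
    constructor
    · rintro ⟨g, hg, hgf⟩
      obtain ⟨rfl, rfl⟩ := Prod.mk.inj hgf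
      refine ⟨⟨⟨g.isometry.lipschitz, hg⟩, ⟨g⁻¹.isometry.lipschitz, ?_⟩⟩, fun y =>
        ⟨g.apply_inv_self y, g.inv_apply_self y⟩⟩
      change dist (g⁻¹ x) x ≤ ρ
      rw [← g.dist_eq, g.apply_inv_self, dist_comm]
      exact hg
    · rintro ⟨⟨⟨hf, hfx⟩, ⟨hk, -⟩⟩, hfk⟩
      have hiso : Isometry f := Isometry.of_dist_eq fun a b => by
        refine le_antisymm (by simpa using hf.dist_le_mul a b) ?_
        have := hk.dist_le_mul (f a) (f b)
        simpa [(hfk _).2] using this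
      let g : X ≃ᵢ X := ⟨⟨f, k, fun y => (hfk y).2, fun y => (hfk y).1⟩, hiso⟩
      exact ⟨g, hfx, rfl⟩
  rw [himage]
  refine (hScpt.prod hScpt).inter_right ?_
  simp only [Set.ofPred_forall]
  refine isClosed_iInter fun y => IsClosed.inter ?_ ?_
  · exact isClosed_eq (ContinuousEval.continuous_eval.comp
      (continuous_fst.prodMk ((continuous_eval_const y).comp continuous_snd))) continuous_const
  · exact isClosed_eq (ContinuousEval.continuous_eval.comp
      (continuous_snd.prodMk ((continuous_eval_const y).comp continuous_fst))) continuous_const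

end IsometryGroupTopology

/-! ### The left invariant metric -/

section LeftDist

variable {X : Type u} [MetricSpace X] (x : X)

theorem dist_le_leftDistScale {R : ℝ} (g h : X ≃ᵢ X) {y : X} (hy : y ∈ Metric.closedBall x R) :
    dist (g y) (h y) ≤ leftDistScale x R g h := by
  refine le_ciSup (f := fun y : Metric.closedBall x R => dist (g y) (h y)) ?_ ⟨y, hy⟩
  refine ⟨R + dist (g x) (h x) + R, ?_⟩
  rintro _ ⟨⟨z, hz⟩, rfl⟩
  have h1 := dist_triangle4 (g z) (g x) (h x) (h z)
  rw [g.dist_eq, h.dist_eq, dist_comm x z] at h1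
  rw [Metric.mem_closedBall] at hz
  change dist (g z) (h z) ≤ _
  linarith

theorem leftDistScale_nonneg (R : ℝ) (g h : X ≃ᵢ X) : 0 ≤ leftDistScale x R g h :=
  Real.iSup_nonneg fun _ => dist_nonneg

theorem leftDist_le {R c : ℝ} (hR : 0 < R) (hc : 0 ≤ c) {g h : X ≃ᵢ X}
    (H : ∀ y ∈ Metric.closedBall x R, dist (g y) (h y) ≤ c) : leftDist x g h ≤ 1 / R + c := by
  refine (ciInf_le ⟨0, ?_⟩ (⟨R, hR⟩ : Set.Ioi (0 : ℝ))).trans ?_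
  · rintro _ ⟨⟨r, hr⟩, rfl⟩
    have := leftDistScale_nonneg x r g h
    have hr' : 0 < r := hr
    positivity
  · exact add_le_add le_rfl (Real.iSup_le (fun y => H y y.2) hc)

theorem exists_of_leftDist_lt {c : ℝ} {g h : X ≃ᵢ X} (H : leftDist x g h < c) :
    ∃ R > 0, ∃ s ≥ 0, 1 / R + s < c ∧ ∀ y ∈ Metric.closedBall x R, dist (g y) (h y) ≤ s := by
  obtain ⟨⟨R, hR⟩, hlt⟩ := exists_lt_of_ciInf_lt H
  exact ⟨R, hR, leftDistScale x R g h, leftDistScale_nonneg x R g h, hlt,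
    fun y hy => dist_le_leftDistScale x g h hy⟩

theorem leftDist_nonneg (g h : X ≃ᵢ X) : 0 ≤ leftDist x g h := by
  refine Real.iInf_nonneg ?_
  rintro ⟨r, hr⟩
  have := leftDistScale_nonneg x r g h
  have hr' : 0 < r := hr
  positivity

theorem leftDist_self (g : X ≃ᵢ X) : leftDist x g g = 0 := by
  refine le_antisymm (le_of_forall_pos_le_add fun δ hδ => ?_) (leftDist_nonneg x g g)
  have := leftDist_le x (R := 1 / δ) (c := 0) (g := g) (h := g) (by positivity) le_rfl (by simp)
  simpa using this

theorem leftDist_comm (g h : X ≃ᵢ X) : leftDist x g h = leftDist x h g := by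
  simp only [leftDist, leftDistScale, dist_comm]

/-- On the smaller of two nearly optimal radii both displacement bounds hold, and `1 / min R R'` is
at most `1 / R + 1 / R'`. -/
theorem leftDist_triangle (g h k : X ≃ᵢ X) :
    leftDist x g k ≤ leftDist x g h + leftDist x h k := by
  refine le_of_forall_pos_le_add fun δ hδ => ?_
  obtain ⟨R, hR, s, hs, hlt, H⟩ := exists_of_leftDist_lt x
    (lt_add_of_pos_right (leftDist x g h) (half_pos hδ))
  obtain ⟨R', hR', s', hs', hlt', H'⟩ := exists_of_leftDist_lt x
    (lt_add_of_pos_right (leftDist x h k) (half_pos hδ))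
  have h1 : leftDist x g k ≤ 1 / min R R' + (s + s') :=
    leftDist_le x (lt_min hR hR') (add_nonneg hs hs') fun y hy =>
      (dist_triangle _ (h y) _).trans (add_le_add
        (H y (Metric.closedBall_subset_closedBall (min_le_left _ _) hy))
        (H' y (Metric.closedBall_subset_closedBall (min_le_right _ _) hy)))
  have h2 : 1 / min R R' ≤ 1 / R + 1 / R' := by
    have := one_div_pos.mpr hR
    have := one_div_pos.mpr hR'
    rcases min_choice R R' with h | h <;> rw [h] <;> linarith
  linarith

theorem dist_apply_le_leftDist (g h : X ≃ᵢ X) : dist (g x) (h x) ≤ leftDist x g h := by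
  refine le_of_forall_pos_le_add fun δ hδ => ?_
  obtain ⟨R, hR, s, hs, hlt, H⟩ := exists_of_leftDist_lt x
    (lt_add_of_pos_right (leftDist x g h) hδ)
  have := H x (Metric.mem_closedBall_self hR.le)
  have := one_div_pos.mpr hR
  linarith

/-- Isometries at small distance are close on large balls. -/
theorem dist_apply_lt_of_leftDist_lt {δ r : ℝ} {g h : X ≃ᵢ X} (hr : 0 < r)
    (H : leftDist x g h < min δ (1 / r)) {y : X} (hy : y ∈ Metric.closedBall x r) :
    dist (g y) (h y) < δ := by
  obtain ⟨R, hR, s, hs, hlt, H⟩ := exists_of_leftDist_lt x H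
  have h1 : 1 / R < 1 / r := by linarith [min_le_right δ (1 / r)]
  have h2 : r < R := (one_div_lt_one_div hR hr).mp h1
  have h3 := H y (Metric.closedBall_subset_closedBall h2.le hy)
  have := one_div_pos.mpr hR
  linarith [min_le_left δ (1 / r)]

theorem eq_of_leftDist_eq_zero {g h : X ≃ᵢ X} (H : leftDist x g h = 0) : g = h := by
  ext y
  refine eq_of_forall_dist_le fun δ hδ => ?_
  have hr : 0 < dist y x + 1 := by positivity
  refine (dist_apply_lt_of_leftDist_lt x hr ?_ ?_).le
  · rw [H]
    exact lt_min hδ (by positivity)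
  · rw [Metric.mem_closedBall]
    linarith

theorem leftDist_mul_left (k g h : X ≃ᵢ X) : leftDist x (k * g) (k * h) = leftDist x g h := by
  simp only [leftDist, leftDistScale, IsometryEquiv.mul_apply, k.dist_eq]

theorem tendsto_isom_iff_leftDist [ProperSpace X] {ι : Type*} {p : Filter ι} {w : ι → X ≃ᵢ X}
    {g : X ≃ᵢ X} :
    Tendsto w p (𝓝 g) ↔ Tendsto (fun i => leftDist x (w i) g) p (𝓝 0) := by
  rw [isInducing_isomToContinuousMap.tendsto_nhds_iff,
    ContinuousMap.tendsto_iff_forall_isCompact_tendstoUniformlyOn]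
  constructor
  · intro H
    rw [Metric.tendsto_nhds]
    intro δ hδ
    filter_upwards [Metric.tendstoUniformlyOn_iff.mp (H _ (isCompact_closedBall x (4 / δ))) (δ / 4)
      (by positivity)] with i hi
    rw [Real.dist_0_eq_abs, abs_of_nonneg (leftDist_nonneg x _ _), leftDist_comm]
    have := leftDist_le x (R := 4 / δ) (c := δ / 4) (g := g) (h := w i) (by positivity)
      (by positivity) fun y hy => (hi y hy).le
    rw [one_div_div] at this
    linarith
  · intro H K hK
    rw [Metric.tendstoUniformlyOn_iff]
    intro δ hδ
    obtain ⟨r, hr⟩ := hK.isBounded.subset_closedBall x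
    have hr' : 0 < max r 1 := by positivity
    filter_upwards [H.eventually (gt_mem_nhds (lt_min hδ (one_div_pos.mpr hr')))] with i hi y hy
    rw [leftDist_comm] at hi
    exact dist_apply_lt_of_leftDist_lt x hr' hi
      (Metric.closedBall_subset_closedBall (le_max_left _ _) (hr hy))

end LeftDist

/-! ### Equivariant approximations approximate the left invariant metrics -/

/-- If the displacement between `g'` and `h'` at points of a large ball is controlled by that
between `g` and `h` at points at almost the same distance from the base point, then the left
distances compare. -/
theorem leftDist_le_leftDist_add {X : Type u} {Y : Type v} [MetricSpace X] [MetricSpace Y]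
    {x : X} {y : Y} {g h : X ≃ᵢ X} {g' h' : Y ≃ᵢ Y} {L D ε : ℝ} (hL : 1 ≤ L) (hε : 0 < ε)
    (hD : leftDist x g h ≤ D) (hεD : ε * (4 * (D + 1)) ≤ 1)
    (H : ∀ z ∈ Metric.closedBall y L, ∃ a, dist a x ≤ dist z y + 2 * ε ∧
      dist (g' z) (h' z) ≤ dist (g a) (h a) + 5 * ε) :
    leftDist y g' h' ≤ leftDist x g h + (1 / L + ε * (4 * (D + 1) ^ 2) + 5 * ε) := by
  have hD0 : 0 ≤ D := (leftDist_nonneg x g h).trans hD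
  refine le_of_forall_pos_le_add fun δ hδ => ?_
  obtain ⟨R, hR, s, hs, hlt, Hs⟩ := exists_of_leftDist_lt x
    (lt_add_of_pos_right (leftDist x g h) (lt_min hδ one_pos))
  have hc1 := min_le_left δ 1
  have hc2 := min_le_right δ 1
  have hR1 : 1 / R < D + 1 := by linarith
  -- The near-optimal radius `R` may exceed `L`, beyond which nothing is known; truncating at `L`
  -- costs `1 / L`. The lower bound keeps `1 / r` stable when the radius is shrunk by `2 * ε`, which
  -- is needed for `a` to stay in the `R`-ball.
  have hr₀ : 1 / (D + 1) ≤ min R L := by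
    refine le_min ?_ ?_
    · rw [div_le_comm₀ (by positivity) hR]
      exact hR1.le
    · refine le_trans ?_ hL
      rw [div_le_one (by positivity)]
      linarith
  set r := min R L with hr
  have hr0 : 0 < r := lt_of_lt_of_le (by positivity) hr₀
  have hε4 : 2 * ε ≤ 1 / (D + 1) / 2 := by
    rw [div_div, le_div_iff₀ (by positivity)]
    linarith
  have hpos : 0 < 1 / (D + 1) / 2 := by positivity
  have hinv : 1 / r ≤ 1 / R + 1 / L := by
    have := one_div_pos.mpr hR
    have : 0 < 1 / L := by positivity
    rcases min_choice R L with h | h <;> rw [hr, h] <;> linarith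
  have hsub : 1 / (r - 2 * ε) ≤ 1 / r + ε * (4 * (D + 1) ^ 2) := by
    have e : 1 / (r - 2 * ε) = 1 / r + 2 * ε * (1 / (r * (r - 2 * ε))) := by
      have : r - 2 * ε ≠ 0 := by linarith
      field_simp
      ring
    rw [e]
    have hle : 1 / (r * (r - 2 * ε)) ≤ 2 * (D + 1) ^ 2 := by
      have h1 : 1 / (D + 1) * (1 / (D + 1) / 2) ≤ r * (r - 2 * ε) :=
        mul_le_mul hr₀ (by linarith) hpos.le hr0.le
      have h2 := one_div_le_one_div_of_le (by positivity) h1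
      refine h2.trans_eq ?_
      field_simp
    have := mul_le_mul_of_nonneg_left hle (by positivity : 0 ≤ 2 * ε)
    linarith
  have := leftDist_le y (R := r - 2 * ε) (c := s + 5 * ε) (g := g') (h := h') (by linarith)
    (by positivity) fun z hz => by
      rw [Metric.mem_closedBall] at hz
      obtain ⟨a, ha, hga⟩ := H z (by
        rw [Metric.mem_closedBall]
        linarith [min_le_right R L])
      have := Hs a (by
        rw [Metric.mem_closedBall]
        linarith [min_le_left R L])
      linarith
  linarith

namespace IsometricAction

theorem dist_act_base_le (A : IsometricAction.{u}) (g : A.G) :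
    dist (A.act g A.base) A.base ≤ A.dl 1 g := by
  rw [dist_comm]
  exact dist_apply_le_leftDist A.base (1 : A.X ≃ᵢ A.X) g

theorem dist_act_act (A : IsometricAction.{u}) (g : A.G) (a b : A.X) :
    dist (A.act g a) (A.act g b) = dist a b := (g : A.X ≃ᵢ A.X).dist_eq a b

theorem dist_act_le (A : IsometricAction.{u}) (g : A.G) (a : A.X) :
    dist (A.act g a) A.base ≤ dist a A.base + dist (A.act g A.base) A.base := by
  have := dist_triangle (A.act g a) (A.act g A.base) A.base
  rwa [dist_act_act] at this

/-- Displacements at `a` and at `f a` differ by at most `3 * ε` (equivariance twice, distortion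
once), and moving from `z` to a nearby `f a` costs `2 * ε` more. The map `ψ` serves only for almost
surjectivity. The value `2 * M + δ` bounds the distances in both groups. -/
theorem IsEquivariantApprox.isBallApprox {A : IsometricAction.{u}} {B : IsometricAction.{v}}
    {ε : ℝ} {f : A.X → B.X} {φ : A.G → B.G} {ψ : B.G → A.G}
    (h : IsEquivariantApprox A B ε f φ ψ) {M L δ : ℝ} (hM : 0 ≤ M) (hδ : 0 < δ) (hε : 0 < ε)
    (hL : 1 ≤ L) (hLδ : 1 / L ≤ δ / 4) (h5 : ε * 5 ≤ δ / 4)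
    (hD : ε * (4 * (2 * M + δ + 1)) ≤ 1) (hD2 : ε * (4 * (2 * M + δ + 1) ^ 2) ≤ δ / 4)
    (hLM : ε * (L + M + 4) ≤ 1) :
    IsBallApprox A.dl B.dl M δ φ := by
  obtain ⟨hbase, hiso, hsurj, -, hψd, heq, heq'⟩ := h
  have hε1 : ε ≤ 1 := by nlinarith
  -- Room for points within `L + 2` of the base moved by elements of displacement at most `M + 2 *
  -- ε`.
  have hr : L + M + 4 ≤ 1 / ε := by
    rw [le_div_iff₀ hε]
    linarith
  have hdisp := fun (g : A.G) (hg : A.dl 1 g ≤ M) => (A.dist_act_base_le g).trans hg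
  have hbase' : A.base ∈ Metric.closedBall A.base (1 / ε) :=
    Metric.mem_closedBall_self (by positivity)
  -- points of the target have preimages, and points of the source images, at the same distance
  have hpre : ∀ z ∈ Metric.closedBall B.base L, ∃ a, dist a A.base ≤ dist z B.base + 2 * ε ∧
      a ∈ Metric.closedBall A.base (1 / ε) ∧ dist (f a) z < ε := fun z hz => by
    obtain ⟨a, ha, haz⟩ := hsurj z (Metric.closedBall_subset_closedBall (by linarith) hz)
    refine ⟨a, ?_, ha, haz⟩
    have h1 := hiso a ha A.base hbase'
    rw [hbase] at h1
    linarith [(abs_lt.mp h1).1, dist_triangle (f a) z B.base]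
  have himg : ∀ a ∈ Metric.closedBall A.base (1 / ε), dist (f a) B.base ≤ dist a A.base + ε :=
    fun a ha => by
      have h1 := hiso a ha A.base hbase'
      rw [hbase] at h1
      linarith [(abs_lt.mp h1).2]
  have hequi : ∀ g : A.G, A.dl 1 g ≤ M → ∀ a, dist a A.base ≤ L + 2 →
      A.act g a ∈ Metric.closedBall A.base (1 / ε) ∧
        dist (f (A.act g a)) (B.act (φ g) (f a)) < ε := fun g hg a ha => by
    have h1 := hdisp g hg
    have h2 : A.act g a ∈ Metric.closedBall A.base (1 / ε) := by
      rw [Metric.mem_closedBall]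
      linarith [A.dist_act_le g a]
    refine ⟨h2, heq g (h1.trans (by linarith)) a ?_ h2⟩
    rw [Metric.mem_closedBall]
    linarith
  have hone : A.dl 1 1 ≤ M := (leftDist_self A.base 1).trans_le hM
  have hupper : ∀ g k : A.G, A.dl 1 g ≤ M → A.dl 1 k ≤ M →
      B.dl (φ g) (φ k) ≤ A.dl g k + (1 / L + ε * (4 * (2 * M + δ + 1) ^ 2) + 5 * ε) := by
    intro g k hg hk
    refine leftDist_le_leftDist_add hL hε ?_ hD fun z hz => ?_
    · have h1 := leftDist_triangle A.base (g : A.X ≃ᵢ A.X) 1 k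
      rw [leftDist_comm A.base (g : A.X ≃ᵢ A.X) 1] at h1
      change A.dl g k ≤ A.dl 1 g + A.dl 1 k at h1
      exact h1.trans (by linarith)
    · obtain ⟨a, ha, haε, haz⟩ := hpre z hz
      refine ⟨a, ha, ?_⟩
      rw [Metric.mem_closedBall] at hz
      obtain ⟨g1, g2⟩ := hequi g hg a (by linarith)
      obtain ⟨k1, k2⟩ := hequi k hk a (by linarith)
      have h1 := (abs_lt.mp (hiso _ g1 _ k1)).2
      have h2 := dist_triangle4 (B.act (φ g) z) (B.act (φ g) (f a)) (B.act (φ k) (f a))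
        (B.act (φ k) z)
      have h3 := dist_triangle4 (B.act (φ g) (f a)) (f (A.act g a)) (f (A.act k a))
        (B.act (φ k) (f a))
      rw [dist_act_act, dist_act_act, dist_comm z] at h2
      rw [dist_comm (B.act (φ g) (f a)) (f _)] at h3
      change dist (B.act (φ g) z) (B.act (φ k) z) ≤ dist (A.act g a) (A.act k a) + 5 * ε
      linarith
  refine ⟨?_, fun g k hg hk => ?_, fun k hk => ⟨ψ k, ?_, ?_⟩⟩
  · refine (leftDist_le B.base (R := L) (c := 3 * ε) (by linarith) (by positivity)
      fun z hz => ?_).trans (by linarith)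
    obtain ⟨a, ha, haε, haz⟩ := hpre z hz
    rw [Metric.mem_closedBall] at hz
    have h1 := (hequi 1 hone a (by linarith)).2
    have h2 := dist_triangle4 z (f a) (B.act (φ 1) (f a)) (B.act (φ 1) z)
    rw [dist_act_act, dist_comm z (f a)] at h2
    change dist z (B.act (φ 1) z) ≤ 3 * ε
    change dist (f a) _ < ε at h1
    linarith
  · have hu := hupper g k hg hk
    rw [abs_le]
    refine ⟨by linarith, ?_⟩
    have h1 : A.dl g k ≤ B.dl (φ g) (φ k) +
        (1 / L + ε * (4 * (2 * M + δ + 1) ^ 2) + 5 * ε) := by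
      refine leftDist_le_leftDist_add hL hε ?_ hD fun a ha => ⟨f a, ?_, ?_⟩
      · have h1 := leftDist_triangle A.base (g : A.X ≃ᵢ A.X) 1 k
        rw [leftDist_comm A.base (g : A.X ≃ᵢ A.X) 1] at h1
        change A.dl g k ≤ A.dl 1 g + A.dl 1 k at h1
        change B.dl (φ g) (φ k) ≤ _
        linarith
      · have := himg a (Metric.closedBall_subset_closedBall (by linarith) ha)
        linarith
      · rw [Metric.mem_closedBall] at ha
        obtain ⟨g1, g2⟩ := hequi g hg a (by linarith)
        obtain ⟨k1, k2⟩ := hequi k hk a (by linarith)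
        have h1 := (abs_lt.mp (hiso _ g1 _ k1)).1
        have h3 := dist_triangle4 (f (A.act g a)) (B.act (φ g) (f a)) (B.act (φ k) (f a))
          (f (A.act k a))
        rw [dist_comm (B.act (φ k) (f a)) (f _)] at h3
        change dist (A.act g a) (A.act k a) ≤ dist (B.act (φ g) (f a)) (B.act (φ k) (f a)) + 5 * ε
        linarith
    linarith
  all_goals
    have hkd : k ∈ B.displ (1 / ε) := ((B.dist_act_base_le k).trans hk).trans (by linarith)
    -- The approximation a priori bounds this displacement only by `1 / ε`; equivariance at the base
    -- point improves the bound.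
    have hψk : dist (A.act (ψ k) A.base) A.base ≤ M + 2 * ε := by
      have h1 : A.act (ψ k) A.base ∈ Metric.closedBall A.base (1 / ε) := hψd hkd
      have h2 := heq' k hkd A.base hbase' h1
      have h3 := (abs_lt.mp (hiso _ h1 _ hbase')).1
      rw [hbase] at h2 h3
      linarith [(B.dist_act_base_le k).trans hk, dist_triangle (f (A.act (ψ k) A.base)) (B.act k B.base) B.base]
    have hequi' : ∀ a, dist a A.base ≤ L + 2 → A.act (ψ k) a ∈ Metric.closedBall A.base (1 / ε) ∧
        dist (f (A.act (ψ k) a)) (B.act k (f a)) < ε := fun a ha => by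
      have h2 : A.act (ψ k) a ∈ Metric.closedBall A.base (1 / ε) := by
        rw [Metric.mem_closedBall]
        linarith [A.dist_act_le (ψ k) a]
      refine ⟨h2, heq' k hkd a ?_ h2⟩
      rw [Metric.mem_closedBall]
      linarith
  · have h1 : A.dl 1 (ψ k) ≤ B.dl 1 k +
        (1 / L + ε * (4 * (2 * M + δ + 1) ^ 2) + 5 * ε) := by
      refine leftDist_le_leftDist_add hL hε ?_ hD fun a ha => ⟨f a, ?_, ?_⟩
      · change B.dl 1 k ≤ _
        linarith
      · have := himg a (Metric.closedBall_subset_closedBall (by linarith) ha)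
        linarith
      · have haε : a ∈ Metric.closedBall A.base (1 / ε) :=
          Metric.closedBall_subset_closedBall (by linarith) ha
        rw [Metric.mem_closedBall] at ha
        obtain ⟨k1, k2⟩ := hequi' a (by linarith)
        have h1 := (abs_lt.mp (hiso a haε _ k1)).1
        have h3 := dist_triangle_right (f a) (f (A.act (ψ k) a)) (B.act k (f a))
        change dist a (A.act (ψ k) a) ≤ dist (f a) (B.act k (f a)) + 5 * ε
        linarith
    linarith
  · refine (leftDist_le B.base (R := L) (c := 5 * ε) (by linarith) (by positivity)
      fun z hz => ?_).trans (by linarith)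
    obtain ⟨a, ha, haε, haz⟩ := hpre z hz
    rw [Metric.mem_closedBall] at hz
    obtain ⟨k1, k2⟩ := hequi' a (by linarith)
    have k3 := heq (ψ k) (hψd hkd) a haε k1
    have h1 := dist_triangle4 (B.act k z) (B.act k (f a)) (B.act (φ (ψ k)) (f a))
      (B.act (φ (ψ k)) z)
    rw [dist_act_act, dist_act_act, dist_comm z] at h1
    have h2 := dist_triangle_left (B.act k (f a)) (B.act (φ (ψ k)) (f a)) (f (A.act (ψ k) a))
    change dist (B.act k z) (B.act (φ (ψ k)) z) ≤ 5 * ε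
    linarith

theorem EqPGHConverges.eventually_isBallApprox {A : ℕ → IsometricAction.{u}}
    {B : IsometricAction.{v}} (h : EqPGHConverges A B) {M δ : ℝ} (hM : 0 ≤ M) (hδ : 0 < δ) :
    ∀ᶠ j in atTop, ∃ Φ : (A j).G → B.G, IsBallApprox (A j).dl B.dl M δ Φ := by
  obtain ⟨ε, hε0, hε, happ⟩ := h
  have hev : ∀ c d : ℝ, 0 < d → ∀ᶠ j in atTop, ε j * c ≤ d := fun c d hd =>
    ((hε.mul_const c).eventually (gt_mem_nhds (by simpa using hd))).mono fun _ => le_of_lt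
  have hL : 1 / max 1 (4 / δ) ≤ δ / 4 := by
    rw [one_div_le (by positivity) (by positivity), one_div_div]
    exact le_max_right _ _
  filter_upwards [hev 5 (δ / 4) (by positivity), hev (4 * (2 * M + δ + 1)) 1 one_pos,
    hev (4 * (2 * M + δ + 1) ^ 2) (δ / 4) (by positivity), hev (max 1 (4 / δ) + M + 4) 1 one_pos]
    with j h1 h2 h3 h4
  obtain ⟨f, φ, ψ, hf⟩ := happ j
  exact ⟨φ, hf.isBallApprox hM hδ (hε0 j) (le_max_left _ _) hL h1 h2 h3 h4⟩

end IsometricAction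

/-! ### The group of an isometric action as a proper metric group -/

namespace IsometricAction

/-- The group of an isometric action with the metric `d_x^ℓ`. -/
noncomputable instance leftMetricSpace (A : IsometricAction.{u}) : MetricSpace A.G :=
  let m : MetricSpace A.G :=
    { dist := A.dl
      dist_self := fun g => leftDist_self A.base g
      dist_comm := fun g h => leftDist_comm A.base g h
      dist_triangle := fun g h k => leftDist_triangle A.base g h k
      eq_of_dist_eq_zero := fun H => Subtype.ext (eq_of_leftDist_eq_zero A.base H) }
  -- The subspace compact-open topology is kept, so the Borel structure and the notion of Haar
  -- measure are those of the statement.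
  m.replaceTopology <| TopologicalSpace.ext_nhds fun g => by
    have key : ∀ p : Filter A.G, p ≤ 𝓝 g ↔ p ≤ @nhds A.G m.toUniformSpace.toTopologicalSpace g := by
      intro p
      have h1 : p ≤ 𝓝 g ↔ Tendsto (fun i : A.G => (i : A.X ≃ᵢ A.X)) p (𝓝 (g : A.X ≃ᵢ A.X)) := by
        rw [nhds_subtype, ← tendsto_iff_comap]
        exact Iff.rfl
      rw [h1, tendsto_isom_iff_leftDist A.base]
      exact (tendsto_iff_dist_tendsto_zero (f := id) (x := p) (a := g)).symm
    exact le_antisymm ((key _).mp le_rfl) ((key _).mpr le_rfl)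

instance isIsometricSMul_left (A : IsometricAction.{u}) : IsIsometricSMul A.G A.G :=
  ⟨fun k => Isometry.of_dist_eq fun g h => leftDist_mul_left A.base k g h⟩

/-- Elements of a `d^ℓ`-ball move the base point a bounded amount, and closedness of `G` transfers
compactness from `Isom(X)`. -/
instance properSpace_left (A : IsometricAction.{u}) : ProperSpace A.G := by
  refine ⟨fun g r => ?_⟩
  have hcpt : IsCompact (Subtype.val ⁻¹' {k : A.X ≃ᵢ A.X | dist (k A.base) A.base ≤
      r + dist ((g : A.X ≃ᵢ A.X) A.base) A.base} : Set A.G) :=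
    A.isClosed_G.isClosedEmbedding_subtypeVal.isCompact_preimage
      (isCompact_setOf_dist_apply_le A.base _)
  refine hcpt.of_isClosed_subset Metric.isClosed_closedBall fun k hk => ?_
  have h1 := dist_apply_le_leftDist A.base (k : A.X ≃ᵢ A.X) g
  have h2 : leftDist A.base (k : A.X ≃ᵢ A.X) g ≤ r := hk
  exact (dist_triangle _ ((g : A.X ≃ᵢ A.X) A.base) _).trans (by linarith)

theorem leftBall_eq_closedBall (A : IsometricAction.{u}) (r : ℝ) :
    A.leftBall r = Metric.closedBall 1 r := setOf_dist_le_eq_closedBall 1 r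

end IsometricAction

theorem ENNReal.iSup_lt_top_iff_exists_toReal_le {w : ℕ → ENNReal} (hw : ∀ n, w n < ⊤) :
    (⨆ n, w n) < ⊤ ↔ ∃ C : ℝ, ∀ n, (w n).toReal ≤ C := by
  constructor
  · exact fun h => ⟨(⨆ n, w n).toReal, fun n => ENNReal.toReal_mono h.ne (le_iSup w n)⟩
  · rintro ⟨C, hC⟩
    exact (iSup_le fun n => (ENNReal.le_ofReal_iff_toReal_le (hw n).ne
      (ENNReal.toReal_nonneg.trans (hC n))).mpr (hC n)).trans_lt ENNReal.ofReal_lt_top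

/-! ### The left invariant case -/

namespace IsometricAction

section Left

variable {A : ℕ → IsometricAction.{u}} {B : IsometricAction.{v}} {μ : ∀ j, Measure (A j).G}

theorem measure_leftBall_lt_top (A : IsometricAction.{u}) (μ : Measure A.G)
    [IsFiniteMeasureOnCompacts μ] (r : ℝ) : μ (A.leftBall r) < ⊤ := by
  rw [leftBall_eq_closedBall]
  exact (isCompact_closedBall _ _).measure_lt_top

theorem LeftPMGHConverges.iSup_measure_leftBall_lt_top [∀ j, IsFiniteMeasureOnCompacts (μ j)]
    {μB : Measure B.G} (h : LeftPMGHConverges A μ B μB) (r : ℝ) :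
    (⨆ j, μ j ((A j).leftBall r)) < ⊤ := by
  rw [ENNReal.iSup_lt_top_iff_exists_toReal_le fun j => (A j).measure_leftBall_lt_top (μ j) r]
  simp only [leftBall_eq_closedBall]
  exact PMGHConverges.exists_measureReal_closedBall_le h r

theorem LeftPMGHConverges.isMulLeftInvariant [∀ j, (μ j).IsHaarMeasure]
    {μB : Measure B.G} (h : LeftPMGHConverges A μ B μB) : μB.IsMulLeftInvariant :=
  PMGHConverges.isMulLeftInvariant h

theorem LeftPMGHConverges.isHaarMeasure_iff [∀ j, (μ j).IsHaarMeasure]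
    {μB : Measure B.G} (h : LeftPMGHConverges A μ B μB) :
    μB.IsHaarMeasure ↔ ∀ r : ℝ, 0 < r → 0 < ⨅ j, μ j ((A j).leftBall r) := by
  simp only [leftBall_eq_closedBall]
  exact PMGHConverges.isHaarMeasure_iff h

/-- Precompactness in the pointed measured sense is boundedness of the measures on balls. -/
theorem EqPGHConverges.leftPrecompact_iff (hconv : EqPGHConverges A B)
    [∀ j, IsFiniteMeasureOnCompacts (μ j)] :
    (∀ s : ℕ → ℕ, StrictMono s → ∃ t : ℕ → ℕ, StrictMono t ∧ ∃ μB : Measure B.G,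
        LeftPMGHConverges (fun k => A (s (t k))) (fun k => μ (s (t k))) B μB) ↔
      ∀ R : ℝ, 0 ≤ R → (⨆ j, μ j ((A j).leftBall R)) < ⊤ := by
  have hfin := fun R j => (A j).measure_leftBall_lt_top (μ j) R
  constructor
  · intro H R _
    rw [ENNReal.iSup_lt_top_iff_exists_toReal_le (hfin R)]
    by_contra hC
    -- If the masses were unbounded, some subsequence would have mass above `n` at index `n`, and no
    -- further subsequence of it could converge.
    have hfreq : ∀ n : ℕ, ∃ᶠ j in atTop, (n : ℝ) < (μ j ((A j).leftBall R)).toReal := by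
      intro n hn
      exact hC (bddAbove_of_eventually_le (hn.mono fun j => not_lt.mp))
    obtain ⟨s, hs, hsn⟩ := extraction_forall_of_frequently hfreq
    obtain ⟨t, ht, μB, hμB⟩ := H s hs
    obtain ⟨C, hC⟩ := (ENNReal.iSup_lt_top_iff_exists_toReal_le fun k => hfin R (s (t k))).mp
      (hμB.iSup_measure_leftBall_lt_top R)
    obtain ⟨n, hn⟩ := exists_nat_gt C
    have h1 := hsn (t n)
    have h2 : (n : ℝ) ≤ t n := Nat.cast_le.mpr ht.le_apply
    linarith [hC n]
  · intro H s hs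
    refine exists_subseq_pmghConverges (fun k => μ (s k)) (fun r => ?_) fun M δ hM hδ =>
      hs.tendsto_atTop.eventually (hconv.eventually_isBallApprox hM hδ)
    obtain ⟨C, hC⟩ := (ENNReal.iSup_lt_top_iff_exists_toReal_le (hfin (max r 0))).mp
      (H _ (le_max_right _ _))
    refine ⟨C, fun k => le_trans ?_ (hC (s k))⟩
    refine ENNReal.toReal_mono (hfin _ _).ne (measure_mono ?_)
    rw [leftBall_eq_closedBall]
    exact Metric.closedBall_subset_closedBall (le_max_left _ _)

end Left

end IsometricAction

/-! ### Inversion exchanges the left and the right invariant metrics -/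

theorem MeasureTheory.Measure.setIntegral_inv_eq {H : Type u} [Group H] [MeasurableSpace H]
    [MeasurableInv H] (μ : Measure H) (f : H → ℝ) (S : Set H) :
    ∫ g in S, f g ∂μ.inv = ∫ g in Inv.inv ⁻¹' S, f g⁻¹ ∂μ :=
  (MeasurableEquiv.inv H).measurableEmbedding.setIntegral_map f S

/-- Conjugate every approximation by inversion, which is an isometry between the two distances
fixing the identity. -/
theorem PMGHConverges.inv {H : ℕ → Type u} [∀ j, Group (H j)] [∀ j, MeasurableSpace (H j)]
    [∀ j, MeasurableInv (H j)] {K : Type v} [Group K] [TopologicalSpace K] [IsTopologicalGroup K]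
    [MeasurableSpace K] [BorelSpace K] {d d' : ∀ j, H j → H j → ℝ} {μ : ∀ j, Measure (H j)}
    {dK dK' : K → K → ℝ} {μK : Measure K} (hd : ∀ j g h, d' j g h = d j g⁻¹ h⁻¹)
    (hdK : ∀ g h, dK' g h = dK g⁻¹ h⁻¹) (h : PMGHConverges d μ dK μK) :
    PMGHConverges d' (fun j => (μ j).inv) dK' μK.inv := by
  obtain ⟨hfin, R, ε, ψ, hR, hε, hψ, hψ1, hiso, hcov, hint⟩ := h
  have hd1 : ∀ j g, d' j 1 g = d j 1 g⁻¹ := fun j g => by rw [hd, inv_one]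
  refine ⟨inferInstance, R, ε, fun j g => (ψ j g⁻¹)⁻¹, hR, hε,
    fun j => ((hψ j).comp measurable_inv).inv, fun j => by simp [hψ1], fun j g h hg hh => ?_,
    fun j k hk => ?_, fun f hf hfs => ?_⟩
  · rw [hd1] at hg hh
    rw [hd, hdK, inv_inv, inv_inv]
    exact hiso j _ _ hg hh
  · rw [hdK, inv_one] at hk
    obtain ⟨g, hg, hkg⟩ := hcov j _ hk
    exact ⟨g⁻¹, by rwa [hd1, inv_inv], by rwa [hdK, inv_inv, inv_inv]⟩
  · have hlim := hint (fun k => f k⁻¹) (hf.comp continuous_inv)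
      (hfs.comp_homeomorph (Homeomorph.inv K))
    have e1 : ∫ k, f k ∂μK.inv = ∫ k, f k⁻¹ ∂μK := by
      simpa using μK.setIntegral_inv_eq f Set.univ
    rw [e1]
    refine hlim.congr fun j => ?_
    rw [Measure.setIntegral_inv_eq]
    simp only [inv_inv, hd1, Set.preimage_ofPred_eq]

theorem isRightHaarMeasure_iff_inv {H : Type u} [Group H] [TopologicalSpace H]
    [IsTopologicalGroup H] [MeasurableSpace H] [BorelSpace H] (μ : Measure H) :
    IsRightHaarMeasure μ ↔ μ.inv.IsHaarMeasure := by
  have hopen : ∀ ν : Measure H, ν.IsOpenPosMeasure → ν.inv.IsOpenPosMeasure := fun ν hν =>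
    (Homeomorph.inv H).continuous.isOpenPosMeasure_map (Homeomorph.inv H).surjective
  constructor
  · rintro ⟨h1, h2, h3⟩
    have := hopen μ h3
    exact { }
  · intro h
    refine ⟨?_, ?_, ?_⟩
    · rw [← μ.inv_inv]
      infer_instance
    · rw [← μ.inv_inv]
      infer_instance
    · rw [← μ.inv_inv]
      exact hopen _ inferInstance

theorem isMulRightInvariant_iff_inv {H : Type u} [Group H] [MeasurableSpace H] [MeasurableMul H]
    [MeasurableInv H] (μ : Measure H) : μ.IsMulRightInvariant ↔ μ.inv.IsMulLeftInvariant := by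
  constructor
  · intro h
    infer_instance
  · intro h
    rw [← μ.inv_inv]
    infer_instance

namespace IsometricAction

theorem dr_eq_dl_inv (A : IsometricAction.{u}) (g h : A.G) : A.dr g h = A.dl g⁻¹ h⁻¹ := rfl

theorem measure_rightBall (A : IsometricAction.{u}) (μ : Measure A.G) (r : ℝ) :
    μ (A.rightBall r) = μ.inv (A.leftBall r) := by
  rw [Measure.inv_apply]
  rfl

theorem rightPMGHConverges_iff {A : ℕ → IsometricAction.{u}} {B : IsometricAction.{v}}
    {μ : ∀ j, Measure (A j).G} {μB : Measure B.G} :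
    RightPMGHConverges A μ B μB ↔ LeftPMGHConverges A (fun j => (μ j).inv) B μB.inv := by
  refine ⟨PMGHConverges.inv (fun j g h => ?_) fun g h => ?_, fun h => ?_⟩
  · rw [dr_eq_dl_inv, inv_inv, inv_inv]
  · rw [dr_eq_dl_inv, inv_inv, inv_inv]
  · have := PMGHConverges.inv (fun j => (A j).dr_eq_dl_inv) B.dr_eq_dl_inv h
    simp only [Measure.inv_inv] at this
    exact this

end IsometricAction

theorem mainTheorem11 (A : ℕ → IsometricAction.{u}) (B : IsometricAction.{v})
    (hconv : IsometricAction.EqPGHConverges A B)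
    (hgeod : ∀ j, IsGeodesicSpace (A j).X) :
    -- left invariant measures and metrics
    (∀ μ : ∀ j, Measure (A j).G, (∀ j, (μ j).IsHaarMeasure) →
      ((∀ s : ℕ → ℕ, StrictMono s → ∃ t : ℕ → ℕ, StrictMono t ∧ ∃ μB : Measure B.G,
          IsometricAction.LeftPMGHConverges (fun k => A (s (t k))) (fun k => μ (s (t k))) B μB) ↔
        ∀ R : ℝ, 0 ≤ R → (⨆ j, μ j ((A j).leftBall R)) < ⊤) ∧
      (∀ s : ℕ → ℕ, StrictMono s → ∀ μB : Measure B.G,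
        IsometricAction.LeftPMGHConverges (fun k => A (s k)) (fun k => μ (s k)) B μB →
          (∀ R : ℝ, 0 ≤ R → (⨆ k, μ (s k) ((A (s k)).leftBall R)) < ⊤) ∧
          μB.IsMulLeftInvariant ∧
          (μB.IsHaarMeasure ↔
            ∀ r : ℝ, 0 < r → 0 < ⨅ k, μ (s k) ((A (s k)).leftBall r)))) ∧
    -- right invariant measures and metrics
    (∀ μ : ∀ j, Measure (A j).G, (∀ j, IsRightHaarMeasure (μ j)) →
      ((∀ s : ℕ → ℕ, StrictMono s → ∃ t : ℕ → ℕ, StrictMono t ∧ ∃ μB : Measure B.G,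
          IsometricAction.RightPMGHConverges (fun k => A (s (t k))) (fun k => μ (s (t k))) B μB) ↔
        ∀ R : ℝ, 0 ≤ R → (⨆ j, μ j ((A j).rightBall R)) < ⊤) ∧
      (∀ s : ℕ → ℕ, StrictMono s → ∀ μB : Measure B.G,
        IsometricAction.RightPMGHConverges (fun k => A (s k)) (fun k => μ (s k)) B μB →
          (∀ R : ℝ, 0 ≤ R → (⨆ k, μ (s k) ((A (s k)).rightBall R)) < ⊤) ∧
          μB.IsMulRightInvariant ∧
          (IsRightHaarMeasure μB ↔
            ∀ r : ℝ, 0 < r → 0 < ⨅ k, μ (s k) ((A (s k)).rightBall r)))) := by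
  refine ⟨fun μ hμ => ⟨hconv.leftPrecompact_iff, fun s hs μB h =>
    ⟨fun R _ => h.iSup_measure_leftBall_lt_top R, h.isMulLeftInvariant, h.isHaarMeasure_iff⟩⟩,
    fun μ hμ => ?_⟩
  have hHaar : ∀ j, (μ j).inv.IsHaarMeasure := fun j =>
    (isRightHaarMeasure_iff_inv (μ j)).mp (hμ j)
  -- The right case becomes the left case for the inverted measures, which are Haar.
  simp only [IsometricAction.measure_rightBall, IsometricAction.rightPMGHConverges_iff]
  refine ⟨?_, fun s hs μB h => ⟨fun R _ => h.iSup_measure_leftBall_lt_top R, ?_, ?_⟩⟩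
  · rw [← hconv.leftPrecompact_iff]
    refine forall₂_congr fun s _ => exists_congr fun t => and_congr_right fun _ => ?_
    exact ⟨fun ⟨μB, h⟩ => ⟨μB.inv, h⟩, fun ⟨μB, h⟩ => ⟨μB.inv, by rwa [Measure.inv_inv]⟩⟩
  · exact (isMulRightInvariant_iff_inv μB).mpr h.isMulLeftInvariant
  · exact (isRightHaarMeasure_iff_inv μB).trans h.isHaarMeasure_iff
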